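/- All representations are finite-dimensional over $\mathbb{Q}$. For a partition $\mu$ of $n$ let $V_\mu$ be the corresponding irreducible representation of $S_n$ (the Specht module, spanned by the polytabloids of shape $\mu$). For a partition $\lambda=(\lambda_1\ge\lambda_2\ge\cdots)$ of $|\lambda|$ and $n\ge|\lambda|+\lambda_1$ put $\lambda[n]=(n-|\lambda|,\lambda_1,\lambda_2,\dots)$ and $V(\lambda)_n=V_{\lambda[n]}$. Identify $S_n$ with the subgroup of $S_{n+1}$ fixing $n+1$. A consistent sequence consists of representations $V_n$ of $S_n$ and linear maps $\phi_n\colon V_n\to V_{n+1}$ with $\phi_n(\sigma v)=\sigma\phi_n(v)$ for $\sigma\in S_n$. The sequence is monotone for $n\ge N$ if for every $n\ge N$, every $\lambda$ for which $V(\lambda)_n$ is defined, every $m\ge 0$ and every subrepresentation $W\le V_n$ isomorphic to $V(\lambda)_n^{\oplus m}$, the $S_{n+1}$-span of $\phi_n(W)$ contains a subrepresentation isomorphic to $V(\lambda)_{n+1}^{\oplus m}$. It is uniformly representation stable with stable range $n\ge N$ if for all $n\ge N$ the map $\phi_n$ is injective and the $S_{n+1}$-span of $\phi_n(V_n)$ is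 $V_{n+1}$, and if for every partition $\lambda$ the multiplicity of $V(\lambda)_n$ in $V_n$ (taken to be $0$ when $V(\lambda)_n$ is not defined) is finite and independent of $n$ for $n\ge N$. Theorem. Let $k\ge 0$ and let $V$ be a finite-dimensional rational representation of $S_k$. For $n\ge k$ let $I_n(V)=\operatorname{Ind}_{S_k\times S_{n-k}}^{S_n}(V\boxtimes\mathbb{Q})$, where $S_{n-k}$ acts trivially on $V\boxtimes\mathbb Q$, and let $\iota_n\colon I_n(V)\to I_{n+1}(V)$ be the natural $S_n$-equivariant map, which sends the class of $\sigma\otimes v$ ($\sigma\in S_n$, $v\in V$) to the class of $\sigma\otimes v$ with $\sigma$ regarded as an element of $S_{n+1}$. Then the consistent sequence $(I_n(V),\iota_n)_{n\ge k}$ is monotone for $n\ge k$ and uniformly representation stable with stable range $n\ge 2k$. -/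

import Mathlib

universe u

namespace RepStability

open scoped MonoidAlgebra

/-! ### Symmetric groups and the standard embeddings -/

/-- The embedding `S_k × S_ℓ → S_{k+ℓ}`: the first factor permutes the first `k` letters, the
second factor permutes the last `ℓ` letters. -/
def youngHom (k ℓ : ℕ) :
    Equiv.Perm (Fin k) × Equiv.Perm (Fin ℓ) →* Equiv.Perm (Fin (k + ℓ)) :=
  (finSumFinEquiv.permCongrHom.toMonoidHom).comp (Equiv.Perm.sumCongrHom (Fin k) (Fin ℓ))

/-- The standard embedding `S_n → S_{n+1}`, whose image fixes the last letter. -/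
def stdHom (n : ℕ) : Equiv.Perm (Fin n) →* Equiv.Perm (Fin (n + 1)) :=
  (youngHom n 1).comp (MonoidHom.inl _ _)

theorem youngHom_castAdd {k ℓ : ℕ} (g : Equiv.Perm (Fin k) × Equiv.Perm (Fin ℓ)) (i : Fin k) :
    youngHom k ℓ g (Fin.castAdd ℓ i) = Fin.castAdd ℓ (g.1 i) := by
  simp [youngHom, Equiv.permCongrHom]

theorem youngHom_natAdd {k ℓ : ℕ} (g : Equiv.Perm (Fin k) × Equiv.Perm (Fin ℓ)) (i : Fin ℓ) :
    youngHom k ℓ g (Fin.natAdd k i) = Fin.natAdd k (g.2 i) := by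
  simp [youngHom, Equiv.permCongrHom]

theorem stdHom_castSucc {n : ℕ} (σ : Equiv.Perm (Fin n)) (i : Fin n) :
    stdHom n σ i.castSucc = (σ i).castSucc :=
  youngHom_castAdd (σ, 1) i

theorem stdHom_last {n : ℕ} (σ : Equiv.Perm (Fin n)) :
    stdHom n σ (Fin.last n) = Fin.last n :=
  youngHom_natAdd (σ, 1) (0 : Fin 1)

theorem youngHom_stdHom {k ℓ : ℕ} (g : Equiv.Perm (Fin k) × Equiv.Perm (Fin ℓ)) :
    youngHom k (ℓ + 1) (g.1, stdHom ℓ g.2) = stdHom (k + ℓ) (youngHom k ℓ g) := by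
  ext x
  congr 1
  induction x using Fin.lastCases with
  | last =>
    have h := youngHom_natAdd (g.1, stdHom ℓ g.2) (Fin.last ℓ)
    rw [stdHom_last] at h
    exact h.trans (stdHom_last (youngHom k ℓ g)).symm
  | cast x =>
    refine Eq.trans ?_ (stdHom_castSucc _ _).symm
    induction x using Fin.addCases with
    | left i =>
      rw [youngHom_castAdd]
      exact youngHom_castAdd (g.1, stdHom ℓ g.2) i
    | right i =>
      rw [youngHom_natAdd]
      have h := youngHom_natAdd (g.1, stdHom ℓ g.2) i.castSucc
      rw [stdHom_castSucc] at h
      exact h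

/-! ### Irreducible representations of `S_n` through polytabloids -/

/-- A tableau of shape `μ`: a bijective labelling of the boxes of `μ` by `Fin n`.
A box is a pair (row, column). -/
abbrev Tableau (μ : YoungDiagram) (n : ℕ) : Type := μ.cells ≃ Fin n

namespace Tableau

variable {μ : YoungDiagram} {n : ℕ}

/-- The row of the box with label `x`. -/
def rowOf (T : Tableau μ n) (x : Fin n) : ℕ := (T.symm x).1.1

/-- The column of the box with label `x`. -/
def colOf (T : Tableau μ n) (x : Fin n) : ℕ := (T.symm x).1.2

/-- `S_n` acts on tableaux by permuting the labels. -/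
instance : MulAction (Equiv.Perm (Fin n)) (Tableau μ n) where
  smul σ T := T.trans σ
  one_smul _ := rfl
  mul_smul _ _ _ := rfl

theorem smul_apply (σ : Equiv.Perm (Fin n)) (T : Tableau μ n) (c : μ.cells) :
    (σ • T) c = σ (T c) := rfl

theorem rowOf_smul (σ : Equiv.Perm (Fin n)) (T : Tableau μ n) (x : Fin n) :
    (σ • T).rowOf x = T.rowOf (σ⁻¹ x) := rfl

theorem colOf_smul (σ : Equiv.Perm (Fin n)) (T : Tableau μ n) (x : Fin n) :
    (σ • T).colOf x = T.colOf (σ⁻¹ x) := rfl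

/-- Two tableaux are row equivalent if they differ by reordering the labels within each row,
that is, if every label lies in the same row of both. -/
def rowSetoid (μ : YoungDiagram) (n : ℕ) : Setoid (Tableau μ n) where
  r T T' := ∀ x, T.rowOf x = T'.rowOf x
  iseqv := ⟨fun _ _ => rfl, fun h x => (h x).symm, fun h h' x => (h x).trans (h' x)⟩

/-- The column stabilizer of `T`: the permutations that preserve the set of entries of each
column of `T`. -/
def colStab (T : Tableau μ n) : Subgroup (Equiv.Perm (Fin n)) where
  carrier := {q | ∀ x, T.colOf (q x) = T.colOf x}
  one_mem' _ := rfl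
  mul_mem' {p q} hp hq x := (hp (q x)).trans (hq x)
  inv_mem' {q} hq x := by simpa using (hq (q⁻¹ x)).symm

instance (T : Tableau μ n) : DecidablePred (· ∈ T.colStab) := fun q =>
  inferInstanceAs (Decidable (∀ x, T.colOf (q x) = T.colOf x))

theorem mem_colStab {T : Tableau μ n} {q : Equiv.Perm (Fin n)} :
    q ∈ T.colStab ↔ ∀ x, T.colOf (q x) = T.colOf x := Iff.rfl

end Tableau

/-- Tabloids of shape `μ`: tableaux up to reordering within the rows. -/
def Tabloid (μ : YoungDiagram) (n : ℕ) : Type := Quotient (Tableau.rowSetoid μ n)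

/-- The tabloid of a tableau. -/
def Tabloid.mk {μ : YoungDiagram} {n : ℕ} (T : Tableau μ n) : Tabloid μ n :=
  Quotient.mk (Tableau.rowSetoid μ n) T

instance (μ : YoungDiagram) (n : ℕ) : MulAction (Equiv.Perm (Fin n)) (Tabloid μ n) where
  smul σ := Quotient.map (σ • ·) fun _ _ h x => h (σ⁻¹ x)
  one_smul t := by induction t using Quotient.inductionOn with | h T => rfl
  mul_smul σ τ t := by induction t using Quotient.inductionOn with | h T => rfl

theorem Tabloid.smul_mk {μ : YoungDiagram} {n : ℕ} (σ : Equiv.Perm (Fin n)) (T : Tableau μ n) :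
    σ • Tabloid.mk T = Tabloid.mk (σ • T) := rfl

/-- The permutation representation `M^μ` of `S_n`, with basis the tabloids of shape `μ`. -/
noncomputable abbrev tabloidRep (μ : YoungDiagram) (n : ℕ) :
    Representation ℚ (Equiv.Perm (Fin n)) ℚ[Tabloid μ n] :=
  Representation.ofMulAction ℚ (Equiv.Perm (Fin n)) (Tabloid μ n)

/-- The polytabloid `v_T = ∑_{q ∈ ColStab T} sign(q) {qT}`. -/
noncomputable def polytabloid {μ : YoungDiagram} {n : ℕ} (T : Tableau μ n) : ℚ[Tabloid μ n] :=
  ∑ q : T.colStab,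
    MonoidAlgebra.single (Tabloid.mk ((q : Equiv.Perm (Fin n)) • T))
      ((Equiv.Perm.sign (q : Equiv.Perm (Fin n)) : ℤ) : ℚ)

theorem tabloidRep_polytabloid {μ : YoungDiagram} {n : ℕ} (σ : Equiv.Perm (Fin n))
    (T : Tableau μ n) : tabloidRep μ n σ (polytabloid T) = polytabloid (σ • T) := by
  have hmem : ∀ q : Equiv.Perm (Fin n), q ∈ T.colStab ↔ σ * q * σ⁻¹ ∈ (σ • T).colStab := by
    intro q
    simp only [Tableau.mem_colStab, Tableau.colOf_smul]
    refine ⟨fun h x => ?_, fun h x => ?_⟩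
    · simpa using h (σ⁻¹ x)
    · simpa using h (σ x)
  unfold polytabloid
  rw [map_sum]
  refine Fintype.sum_equiv
    ((MulAut.conj σ).toEquiv.subtypeEquiv (p := (· ∈ T.colStab)) (q := (· ∈ (σ • T).colStab))
      hmem) _ _ fun q => ?_
  rw [Representation.ofMulAction_single, Tabloid.smul_mk]
  have h1 : (((MulAut.conj σ).toEquiv.subtypeEquiv (p := (· ∈ T.colStab))
      (q := (· ∈ (σ • T).colStab)) hmem q : (σ • T).colStab) : Equiv.Perm (Fin n)) =
      σ * q * σ⁻¹ := rfl
  rw [h1, smul_smul, smul_smul]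
  congr 1
  · simp
  · rw [map_mul, map_mul, Equiv.Perm.sign_inv, mul_comm (Equiv.Perm.sign σ), mul_assoc,
      Int.units_mul_self, mul_one]

/-- The Specht module of shape `μ` (for `μ` with `n` boxes, the irreducible representation `V_μ`
of `S_n`): the span in `M^μ` of all polytabloids of shape `μ`. -/
noncomputable def specht (μ : YoungDiagram) (n : ℕ) : Subrepresentation (tabloidRep μ n) where
  toSubmodule := Submodule.span ℚ (Set.range polytabloid)
  apply_mem_toSubmodule σ v hv := by
    have h : Submodule.span ℚ (Set.range polytabloid) ≤
        (Submodule.span ℚ (Set.range (polytabloid (μ := μ) (n := n)))).comap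
          (tabloidRep μ n σ) := by
      rw [Submodule.span_le]
      rintro _ ⟨T, rfl⟩
      exact Submodule.subset_span ⟨σ • T, (tabloidRep_polytabloid σ T).symm⟩
    exact h hv

/-- The condition `n ≥ |lam| + lam_1`, under which `lam[n]` and `V(lam)_n` are defined. -/
def IsPaddable (lam : YoungDiagram) (n : ℕ) : Prop := lam.card + lam.rowLen 0 ≤ n

theorem IsPaddable.succ {lam : YoungDiagram} {n : ℕ} (h : IsPaddable lam n) :
    IsPaddable lam (n + 1) :=
  Nat.le_succ_of_le h

/-- The partition `lam[n] = (n - |lam|, lam_1, lam_2, …)` of `n`. -/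
def padded (lam : YoungDiagram) (n : ℕ) (h : IsPaddable lam n) : YoungDiagram :=
  YoungDiagram.ofRowLens ((n - lam.card) :: lam.rowLens) <| by
    rw [List.sortedGE_iff_pairwise, List.pairwise_cons]
    refine ⟨fun x hx => ?_, lam.rowLens_sorted.pairwise⟩
    rw [YoungDiagram.rowLens, List.mem_map] at hx
    obtain ⟨i, -, rfl⟩ := hx
    have h1 := lam.rowLen_anti 0 i (Nat.zero_le i)
    unfold IsPaddable at h
    change lam.rowLen i ≤ n - lam.card
    omega

/-- The irreducible representation `V(lam)_n = V_{lam[n]}` of `S_n`. -/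
noncomputable def stableIrrep (lam : YoungDiagram) (n : ℕ) (h : IsPaddable lam n) :
    Representation ℚ (Equiv.Perm (Fin n)) (specht (padded lam n h) n).toSubmodule :=
  (specht (padded lam n h) n).toRepresentation

/-! ### Isotypic subrepresentations, multiplicities, spans -/

section General

variable {G : Type*} [Group G] {U V : Type*} [AddCommGroup U] [Module ℚ U] [AddCommGroup V]
  [Module ℚ V]

/-- `W ≅ U^{⊕ m}` as representations, for a subrepresentation `W`. -/
def IsCopies {ρ : Representation ℚ G V} (W : Subrepresentation ρ) (τ : Representation ℚ G U)
    (m : ℕ) : Prop :=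
  Nonempty (W.toRepresentation.Equiv (Representation.directSum fun _ : Fin m => τ))

/-- The multiplicity of an irreducible representation `τ` in `ρ`: the supremum of all `m` such
that `ρ` has a subrepresentation isomorphic to `τ^{⊕ m}`. -/
noncomputable def multiplicity (τ : Representation ℚ G U) (ρ : Representation ℚ G V) : ℕ∞ :=
  sSup {c : ℕ∞ | ∃ m : ℕ, c = m ∧ ∃ W : Subrepresentation ρ, IsCopies W τ m}

/-- The `G`-span of a subset `S` of a representation. -/
def groupSpan (ρ : Representation ℚ G V) (S : Set V) : Subrepresentation ρ where
  toSubmodule := Submodule.span ℚ {v | ∃ g : G, ∃ s ∈ S, v = ρ g s}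
  apply_mem_toSubmodule g v hv := by
    have h : Submodule.span ℚ {v | ∃ g : G, ∃ s ∈ S, v = ρ g s} ≤
        (Submodule.span ℚ {v | ∃ g : G, ∃ s ∈ S, v = ρ g s}).comap (ρ g) := by
      rw [Submodule.span_le]
      rintro _ ⟨g', s, hs, rfl⟩
      exact Submodule.subset_span ⟨g * g', s, hs, by rw [map_mul]; rfl⟩
    exact h hv

end General

/-! ### Consistent sequences, representation stability, monotonicity -/

/-- A consistent sequence `V_k → V_{k+1} → V_{k+2} → ⋯` of finite-dimensional rational
representations of `S_k, S_{k+1}, S_{k+2}, …`. The term of index `ℓ` is `V_n` for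
`n = k + ℓ`. -/
structure ConsistentSequence (k : ℕ) where
  /-- The vector space `V_{k+ℓ}`. -/
  V : ℕ → Type u
  [addCommGroup : ∀ ℓ, AddCommGroup (V ℓ)]
  [module : ∀ ℓ, Module ℚ (V ℓ)]
  [finiteDimensional : ∀ ℓ, FiniteDimensional ℚ (V ℓ)]
  /-- The action of `S_{k+ℓ}` on `V_{k+ℓ}`. -/
  ρ : ∀ ℓ, Representation ℚ (Equiv.Perm (Fin (k + ℓ))) (V ℓ)
  /-- The map `V_{k+ℓ} → V_{k+ℓ+1}`. -/
  φ : ∀ ℓ, V ℓ →ₗ[ℚ] V (ℓ + 1)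
  equivariant : ∀ ℓ (σ : Equiv.Perm (Fin (k + ℓ))) (v : V ℓ),
    φ ℓ (ρ ℓ σ v) = ρ (ℓ + 1) (stdHom (k + ℓ) σ) (φ ℓ v)

namespace ConsistentSequence

attribute [instance] addCommGroup module finiteDimensional

variable {k : ℕ} (S : ConsistentSequence.{u} k)

open Classical in
/-- The multiplicity `c_lam(V_n)` of `V(lam)_n` in `V_n`, for `n = k + ℓ`; it is zero if
`V(lam)_n` is not defined. -/
noncomputable def mult (lam : YoungDiagram) (ℓ : ℕ) : ℕ∞ :=
  if h : IsPaddable lam (k + ℓ) then multiplicity (stableIrrep lam (k + ℓ) h) (S.ρ ℓ) else 0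

/-- The `S_{n+1}`-span of the image under `φ_n` of a subspace `W` of `V_n`, for `n = k + ℓ`. -/
noncomputable def spanImage (ℓ : ℕ) (W : Submodule ℚ (S.V ℓ)) :
    Subrepresentation (S.ρ (ℓ + 1)) :=
  groupSpan (S.ρ (ℓ + 1)) (S.φ ℓ '' (W : Set (S.V ℓ)))

/-- Monotonicity for `n ≥ N`: for each `n ≥ N`, if `W` is a subrepresentation of `V_n` isomorphic
to `V(lam)_n^{⊕ m}`, then the `S_{n+1}`-span of `φ_n(W)` contains a subrepresentation isomorphic
to `V(lam)_{n+1}^{⊕ m}`. -/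
def IsMonotone (N : ℕ) : Prop :=
  ∀ ℓ : ℕ, N ≤ k + ℓ →
    ∀ (lam : YoungDiagram) (h : IsPaddable lam (k + ℓ)) (m : ℕ)
      (W : Subrepresentation (S.ρ ℓ)),
      IsCopies W (stableIrrep lam (k + ℓ) h) m →
        ∃ U : Subrepresentation (S.ρ (ℓ + 1)),
          U ≤ S.spanImage ℓ W.toSubmodule ∧
            IsCopies U (stableIrrep lam (k + (ℓ + 1)) h.succ) m

/-- Uniform representation stability with stable range `n ≥ N`. -/
structure IsUniformlyRepresentationStable (N : ℕ) : Prop where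
  injectivity : ∀ ℓ, N ≤ k + ℓ → Function.Injective (S.φ ℓ)
  surjectivity : ∀ ℓ, N ≤ k + ℓ → (S.spanImage ℓ ⊤).toSubmodule = ⊤
  multiplicity_stable : ∀ lam : YoungDiagram, ∃ c : ℕ, ∀ ℓ, N ≤ k + ℓ → S.mult lam ℓ = c

end ConsistentSequence

/-! ### The sequence of induced representations -/

section Induced

variable {k : ℕ} {V : Type u} [AddCommGroup V] [Module ℚ V]
  (ρ : Representation ℚ (Equiv.Perm (Fin k)) V)

/-- The representation `V ⊠ ℚ` of `S_k × S_ℓ`: the space `V`, on which `S_ℓ` acts trivially. -/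
abbrev boxTrivial (ℓ : ℕ) : Representation ℚ (Equiv.Perm (Fin k) × Equiv.Perm (Fin ℓ)) V :=
  ρ.comp (MonoidHom.fst _ _)

/-- The space of `I_{k+ℓ}(V) = Ind_{S_k × S_ℓ}^{S_{k+ℓ}} (V ⊠ ℚ)`. -/
abbrev IndSpace (ℓ : ℕ) : Type u := Representation.IndV (youngHom k ℓ) (boxTrivial ρ ℓ)

/-- The representation `I_{k+ℓ}(V) = Ind_{S_k × S_ℓ}^{S_{k+ℓ}} (V ⊠ ℚ)` of `S_{k+ℓ}`. -/
noncomputable abbrev indRep (ℓ : ℕ) :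
    Representation ℚ (Equiv.Perm (Fin (k + ℓ))) (IndSpace ρ ℓ) :=
  Representation.ind (youngHom k ℓ) (boxTrivial ρ ℓ)

/-- The natural map `ι_n : I_n(V) → I_{n+1}(V)` for `n = k + ℓ`. It sends the class of `σ ⊗ v` to
the class of `σ ⊗ v`, where on the right `σ ∈ S_n` is regarded as an element of `S_{n+1}`. -/
noncomputable def indInclusion (ℓ : ℕ) : IndSpace ρ ℓ →ₗ[ℚ] IndSpace ρ (ℓ + 1) :=
  Representation.Coinvariants.lift _
    (Representation.Coinvariants.mk _ ∘ₗ
      (MonoidAlgebra.mapDomainLinearMap ℚ ℚ (stdHom (k + ℓ))).rTensor V) <| by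
    intro g
    ext σ v
    have h := youngHom_stdHom g
    have key := Representation.Coinvariants.mk_self_apply
      (Representation.tprod ((Representation.leftRegular ℚ
        (Equiv.Perm (Fin (k + (ℓ + 1))))).comp (youngHom k (ℓ + 1))) (boxTrivial ρ (ℓ + 1)))
      (g.1, stdHom ℓ g.2)
      (TensorProduct.tmul ℚ (MonoidAlgebra.single (stdHom (k + ℓ) σ) (1 : ℚ)) v)
    rw [Representation.tprod_apply, TensorProduct.map_tmul, MonoidHom.comp_apply, h,
      Representation.ofMulAction_single, smul_eq_mul, ← map_mul] at key
    simpa using key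

theorem indInclusion_mk (ℓ : ℕ) (σ : Equiv.Perm (Fin (k + ℓ))) (v : V) :
    indInclusion ρ ℓ (Representation.IndV.mk (youngHom k ℓ) (boxTrivial ρ ℓ) σ v) =
      Representation.IndV.mk (youngHom k (ℓ + 1)) (boxTrivial ρ (ℓ + 1))
        (stdHom (k + ℓ) σ) v := by
  simp [indInclusion]

theorem indInclusion_equivariant (ℓ : ℕ) (σ : Equiv.Perm (Fin (k + ℓ))) (x : IndSpace ρ ℓ) :
    indInclusion ρ ℓ (indRep ρ ℓ σ x) =
      indRep ρ (ℓ + 1) (stdHom (k + ℓ) σ) (indInclusion ρ ℓ x) := by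
  have h : indInclusion ρ ℓ ∘ₗ indRep ρ ℓ σ =
      indRep ρ (ℓ + 1) (stdHom (k + ℓ) σ) ∘ₗ indInclusion ρ ℓ := by
    refine Representation.IndV.hom_ext _ _ fun τ => LinearMap.ext fun v => ?_
    change indInclusion ρ ℓ (indRep ρ ℓ σ (Representation.IndV.mk _ _ τ v)) =
      indRep ρ (ℓ + 1) (stdHom (k + ℓ) σ) (indInclusion ρ ℓ (Representation.IndV.mk _ _ τ v))
    rw [indInclusion_mk, Representation.ind_mk, indInclusion_mk, map_mul, map_inv]
    exact (Representation.ind_mk (youngHom k (ℓ + 1)) (boxTrivial ρ (ℓ + 1)) _ _ _).symm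
  exact LinearMap.congr_fun h x

/-- The consistent sequence `I_n(V) = Ind_{S_k × S_{n-k}}^{S_n} (V ⊠ ℚ)`, `n ≥ k`, with the
natural inclusions. -/
noncomputable def inducedSequence [FiniteDimensional ℚ V] : ConsistentSequence.{u} k where
  V := IndSpace ρ
  finiteDimensional := fun _ => inferInstance
  ρ := indRep ρ
  φ := indInclusion ρ
  equivariant := indInclusion_equivariant ρ

end Induced

end RepStability

/-! The space I_n(V) is a direct sum of copies of V indexed by the cosets of S_k × S_{n-k}, and
everything is tested on the component P_n : I_n(V) → V of the identity coset (`indProj`). P_n is S_k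
× S_{n-k}-equivariant, a vector x vanishes as soon as P_n(σx) = 0 for all σ (`ind_eq_zero`), and
P_{n+1} ι_n = P_n. This gives injectivity of ι_n. Its image generates because I_{n+1}(V) is spanned
by translates of the classes of 1 ⊗ v.

Monotonicity. Let f_1, …, f_m : V(λ)_n → I_n(V) be the embeddings given by W, let T be a tableau of
shape λ[n], and let T' be T with the new letter put at the end of the top row, alone in its column.
The column group does not change. The row group of T' consists of the products of a transposition (i
n+1), i in the top row (the identity if i = n+1), with an element of the row group of T. Hence row
and column symmetrizing ι f_i(v_T) for T' gives a nonzero multiple of ∑_i (i n+1) ι applied to the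
image under f_i of the row symmetrized v_T. The operator ∑_i (i n+1) ι is injective, since P_{n+1}σ
turns it into P_nσ times the number of i that σ sends outside the first k letters
(`swapSum_injective`). By an invariant form, one more column symmetrization keeps these vectors
independent (`rowSym_colSym_eq_zero`). They are then the images of v_{T'} under m independent maps
from V(λ)_{n+1}, which assemble to m copies (`exists_isCopies`).

Multiplicities. By Frobenius reciprocity, equivariant maps V(λ)_n → I_n(V) correspond to equivariant
maps V(λ)_n → V. The latter are invariant under permutations of the last n-k letters, so they kill
each polytabloid with two such letters in one column. If |λ| > k, the pigeonhole principle makes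
them all zero. If |λ| ≤ k and n ≥ 2k, such a map on V(λ)_{n+1} is determined by its restriction
along V(λ)_n → V(λ)_{n+1} (`eq_zero_of_comp_spechtMap_eq_zero`), so the multiplicity cannot grow
from n to n+1. By monotonicity it cannot drop. -/

namespace RepStability

open scoped MonoidAlgebra

/-! ### Linear maps out of free modules -/

section Free

variable {H X : Type*} [AddCommGroup X] [Module ℚ X]

/-- The linear extension of a function on a basis. -/
noncomputable def linExt (F : H → X) : ℚ[H] →ₗ[ℚ] X :=
  Finsupp.linearCombination ℚ F ∘ₗ (MonoidAlgebra.coeffLinearEquiv ℚ).toLinearMap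

@[simp]
theorem linExt_single (F : H → X) (h : H) (r : ℚ) :
    linExt F (MonoidAlgebra.single h r) = r • F h := by
  simp [linExt]

theorem linear_ext_single {f g : ℚ[H] →ₗ[ℚ] X}
    (h : ∀ x, f (MonoidAlgebra.single x 1) = g (MonoidAlgebra.single x 1)) : f = g :=
  MonoidAlgebra.lhom_ext' fun x => LinearMap.ext_ring (h x)

end Free

/-! ### Permutations -/

theorem stdHom_injective (n : ℕ) : Function.Injective (stdHom n) := by
  intro σ τ h
  ext i
  have := congrArg (fun f : Equiv.Perm (Fin (n + 1)) => (f i.castSucc : ℕ)) h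
  simpa [stdHom_castSucc] using this

theorem youngHom_injective (k ℓ : ℕ) : Function.Injective (youngHom k ℓ) := by
  rintro ⟨a, b⟩ ⟨c, d⟩ h
  ext i
  · have := congrArg (fun f : Equiv.Perm (Fin (k + ℓ)) => (f (Fin.castAdd ℓ i) : ℕ)) h
    simpa [youngHom_castAdd] using this
  · have := congrArg (fun f : Equiv.Perm (Fin (k + ℓ)) => (f (Fin.natAdd k i) : ℕ)) h
    simpa [youngHom_natAdd] using this

theorem mem_range_youngHom_of_forall_lt {k ℓ : ℕ} {σ : Equiv.Perm (Fin (k + ℓ))}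
    (h : ∀ i : Fin (k + ℓ), (i : ℕ) < k → (σ i : ℕ) < k) : σ ∈ (youngHom k ℓ).range := by
  obtain ⟨g, hg⟩ := Equiv.Perm.mem_sumCongrHom_range_of_perm_mapsTo_inl
    (σ := finSumFinEquiv.permCongrHom.symm σ) (by
      rintro _ ⟨i, rfl⟩
      have h1 := h (Fin.castAdd ℓ i) (by simp)
      refine ⟨⟨_, h1⟩, ?_⟩
      apply finSumFinEquiv.injective
      change _ = finSumFinEquiv (finSumFinEquiv.symm (σ (finSumFinEquiv (Sum.inl i))))
      rw [Equiv.apply_symm_apply, finSumFinEquiv_apply_left, finSumFinEquiv_apply_left]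
      ext
      simp)
  refine ⟨g, ?_⟩
  change finSumFinEquiv.permCongrHom (Equiv.Perm.sumCongrHom (Fin k) (Fin ℓ) g) = σ
  rw [hg]
  exact MulEquiv.apply_symm_apply _ σ

theorem youngHom_lt {k ℓ : ℕ} (g : Equiv.Perm (Fin k) × Equiv.Perm (Fin ℓ)) {i : Fin (k + ℓ)}
    (hi : (i : ℕ) < k) : (youngHom k ℓ g i : ℕ) < k := by
  have : i = Fin.castAdd ℓ ⟨i, hi⟩ := by ext; simp
  rw [this, youngHom_castAdd]
  simp

/-- A permutation fixing the first `k` letters comes from the second factor. -/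
theorem exists_youngHom_one {k ℓ : ℕ} {σ : Equiv.Perm (Fin (k + ℓ))}
    (h : ∀ i : Fin (k + ℓ), (i : ℕ) < k → σ i = i) :
    ∃ g : Equiv.Perm (Fin ℓ), youngHom k ℓ (1, g) = σ := by
  obtain ⟨⟨a, b⟩, rfl⟩ := mem_range_youngHom_of_forall_lt (σ := σ) fun i hi => by rwa [h i hi]
  refine ⟨b, ?_⟩
  suffices a = 1 by rw [this]
  ext i
  have := h (Fin.castAdd ℓ i) (by simp)
  rw [youngHom_castAdd] at this
  simpa using congrArg Fin.val this

theorem exists_stdHom_eq {n : ℕ} {σ : Equiv.Perm (Fin (n + 1))} (h : σ (Fin.last n) = Fin.last n) :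
    ∃ τ, stdHom n τ = σ := by
  obtain ⟨⟨a, b⟩, rfl⟩ := mem_range_youngHom_of_forall_lt (k := n) (ℓ := 1) (σ := σ) fun i hi => by
    have h1 : σ i ≠ Fin.last n := fun h2 => by
      rw [← h] at h2
      have := σ.injective h2
      simp [this] at hi
    exact Fin.val_lt_last h1
  exact ⟨a, by rw [Subsingleton.elim b 1]; rfl⟩

theorem sign_stdHom {n : ℕ} (σ : Equiv.Perm (Fin n)) :
    Equiv.Perm.sign (stdHom n σ) = Equiv.Perm.sign σ := by
  change Equiv.Perm.sign (finSumFinEquiv.permCongr (Equiv.Perm.sumCongr σ 1)) = _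
  rw [Equiv.Perm.sign_permCongr, Equiv.Perm.sign_sumCongr]
  simp

/-! ### Induced representations: the projection to the identity component -/

section Induced

variable {k : ℕ} {V : Type*} [AddCommGroup V] [Module ℚ V]
  (ρ : Representation ℚ (Equiv.Perm (Fin k)) V) (ℓ : ℕ)

/-- The class of `σ ⊗ v` in the induced representation. -/
noncomputable abbrev indMk (σ : Equiv.Perm (Fin (k + ℓ))) (v : V) : IndSpace ρ ℓ :=
  Representation.IndV.mk (youngHom k ℓ) (boxTrivial ρ ℓ) σ v

theorem indRep_indMk (σ τ : Equiv.Perm (Fin (k + ℓ))) (v : V) :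
    indRep ρ ℓ σ (indMk ρ ℓ τ v) = indMk ρ ℓ (τ * σ⁻¹) v :=
  Representation.ind_mk _ _ _ _ _

theorem indMk_youngHom_mul (g : Equiv.Perm (Fin k) × Equiv.Perm (Fin ℓ))
    (σ : Equiv.Perm (Fin (k + ℓ))) (v : V) :
    indMk ρ ℓ (youngHom k ℓ g * σ) (ρ g.1 v) = indMk ρ ℓ σ v := by
  have key := Representation.Coinvariants.mk_self_apply
    (Representation.tprod ((Representation.leftRegular ℚ
      (Equiv.Perm (Fin (k + ℓ)))).comp (youngHom k ℓ)) (boxTrivial ρ ℓ))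
    g (TensorProduct.tmul ℚ (MonoidAlgebra.single σ (1 : ℚ)) v)
  rw [Representation.tprod_apply, TensorProduct.map_tmul, MonoidHom.comp_apply,
    Representation.ofMulAction_single] at key
  exact key

theorem ind_hom_ext {X : Type*} [AddCommGroup X] [Module ℚ X] {f g : IndSpace ρ ℓ →ₗ[ℚ] X}
    (h : ∀ σ v, f (indMk ρ ℓ σ v) = g (indMk ρ ℓ σ v)) : f = g :=
  Representation.IndV.hom_ext _ _ fun σ => LinearMap.ext fun v => h σ v

open Classical in
/-- The projection `I_n(V) → V` to the component of the identity coset. -/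
noncomputable def indProj : IndSpace ρ ℓ →ₗ[ℚ] V :=
  Representation.Coinvariants.lift _
    (TensorProduct.lift (linExt fun σ : Equiv.Perm (Fin (k + ℓ)) =>
      if h : ∃ g, youngHom k ℓ g = σ then ρ (h.choose.1)⁻¹ else 0)) <| by
    intro g
    refine TensorProduct.ext (linear_ext_single fun σ => LinearMap.ext fun v => ?_)
    simp only [Representation.tprod_apply, LinearMap.compr₂ₛₗ_apply, TensorProduct.mk_apply,
      LinearMap.coe_comp, Function.comp_apply, TensorProduct.map_tmul, MonoidHom.coe_comp,
      Representation.ofMulAction_single, TensorProduct.lift.tmul, linExt_single, one_smul,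
      MonoidHom.coe_fst, smul_eq_mul]
    by_cases h : ∃ g', youngHom k ℓ g' = σ
    · have h' : ∃ g', youngHom k ℓ g' = youngHom k ℓ g * σ := by
        obtain ⟨g', rfl⟩ := h
        exact ⟨g * g', map_mul _ _ _⟩
      have e : h'.choose = g * h.choose :=
        youngHom_injective k ℓ (by rw [h'.choose_spec, map_mul, h.choose_spec])
      rw [dif_pos h, dif_pos h', e, ← Module.End.mul_apply, ← map_mul]
      simp
    · have h' : ¬ ∃ g', youngHom k ℓ g' = youngHom k ℓ g * σ := by
        rintro ⟨g', hg'⟩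
        exact h ⟨g⁻¹ * g', by rw [map_mul, hg', map_inv, inv_mul_cancel_left]⟩
      rw [dif_neg h, dif_neg h']
      rfl

theorem indProj_mk_youngHom (g : Equiv.Perm (Fin k) × Equiv.Perm (Fin ℓ)) (v : V) :
    indProj ρ ℓ (indMk ρ ℓ (youngHom k ℓ g) v) = ρ g.1⁻¹ v := by
  have h : ∃ g', youngHom k ℓ g' = youngHom k ℓ g := ⟨g, rfl⟩
  have e : h.choose = g := youngHom_injective k ℓ h.choose_spec
  simp only [indProj, indMk, Representation.IndV.mk, LinearMap.comp_apply,
    Representation.Coinvariants.lift_mk, TensorProduct.mk_apply, TensorProduct.lift.tmul,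
    linExt_single, one_smul]
  rw [dif_pos h, e]

theorem indProj_mk_of_notMem {σ : Equiv.Perm (Fin (k + ℓ))} (h : σ ∉ (youngHom k ℓ).range)
    (v : V) : indProj ρ ℓ (indMk ρ ℓ σ v) = 0 := by
  have h : ¬ ∃ g', youngHom k ℓ g' = σ := h
  simp only [indProj, indMk, Representation.IndV.mk, LinearMap.comp_apply,
    Representation.Coinvariants.lift_mk, TensorProduct.mk_apply, TensorProduct.lift.tmul,
    linExt_single, one_smul]
  rw [dif_neg h]
  rfl

theorem indProj_youngHom (g : Equiv.Perm (Fin k) × Equiv.Perm (Fin ℓ)) (x : IndSpace ρ ℓ) :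
    indProj ρ ℓ (indRep ρ ℓ (youngHom k ℓ g) x) = ρ g.1 (indProj ρ ℓ x) := by
  suffices indProj ρ ℓ ∘ₗ indRep ρ ℓ (youngHom k ℓ g) = ρ g.1 ∘ₗ indProj ρ ℓ from
    LinearMap.congr_fun this x
  refine ind_hom_ext ρ ℓ fun σ v => ?_
  rw [LinearMap.comp_apply, LinearMap.comp_apply, indRep_indMk]
  by_cases h : σ ∈ (youngHom k ℓ).range
  · obtain ⟨g', rfl⟩ := h
    rw [← map_inv, ← map_mul, indProj_mk_youngHom, indProj_mk_youngHom, ← Module.End.mul_apply,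
      ← map_mul]
    simp
  · rw [indProj_mk_of_notMem ρ ℓ h, map_zero, indProj_mk_of_notMem]
    rwa [Subgroup.mul_mem_cancel_right _ ((youngHom k ℓ).range.inv_mem ⟨g, rfl⟩)]

/-! ### Frobenius reciprocity by averaging -/

/-- The equivariant map to the induced representation attached to a linear map to `V`. -/
noncomputable def indLift {X : Type*} [AddCommGroup X] [Module ℚ X]
    (τ : Representation ℚ (Equiv.Perm (Fin (k + ℓ))) X) (ψ : X →ₗ[ℚ] V) :
    X →ₗ[ℚ] IndSpace ρ ℓ :=
  ∑ σ, Representation.IndV.mk (youngHom k ℓ) (boxTrivial ρ ℓ) σ ∘ₗ ψ ∘ₗ τ σ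

theorem indLift_apply {X : Type*} [AddCommGroup X] [Module ℚ X]
    (τ : Representation ℚ (Equiv.Perm (Fin (k + ℓ))) X) (ψ : X →ₗ[ℚ] V) (x : X) :
    indLift ρ ℓ τ ψ x = ∑ σ, indMk ρ ℓ σ (ψ (τ σ x)) := by
  simp only [indLift, LinearMap.sum_apply, LinearMap.comp_apply]

theorem indLift_equivariant {X : Type*} [AddCommGroup X] [Module ℚ X]
    (τ : Representation ℚ (Equiv.Perm (Fin (k + ℓ))) X) (ψ : X →ₗ[ℚ] V)
    (σ : Equiv.Perm (Fin (k + ℓ))) (x : X) :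
    indLift ρ ℓ τ ψ (τ σ x) = indRep ρ ℓ σ (indLift ρ ℓ τ ψ x) := by
  rw [indLift_apply, indLift_apply, map_sum]
  refine Fintype.sum_equiv (Equiv.mulRight σ) _ _ fun π => ?_
  rw [indRep_indMk, Equiv.coe_mulRight, mul_inv_cancel_right, map_mul, Module.End.mul_apply]

theorem sum_indProj_eq {W : Type*} [AddCommGroup W] [Module ℚ W]
    (F : Equiv.Perm (Fin (k + ℓ)) → W) (hF : ∀ σ, σ ∉ (youngHom k ℓ).range → F σ = 0) :
    ∑ σ, F σ = ∑ g, F (youngHom k ℓ g) := by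
  classical
  rw [← Finset.sum_image (f := F) (s := Finset.univ) (g := youngHom k ℓ)
    (fun a _ b _ h => youngHom_injective k ℓ h)]
  symm
  refine Finset.sum_subset (Finset.subset_univ _) fun σ _ hσ => hF σ fun ⟨g, hg⟩ => hσ ?_
  exact Finset.mem_image.2 ⟨g, Finset.mem_univ _, hg⟩

/-- Only the summands σ in S_k × S_ℓ reach the identity component, and by equivariance each
contributes ψ x. With `indLift_indProj`, this is Frobenius reciprocity up to a nonzero scalar. -/
theorem indProj_indLift {X : Type*} [AddCommGroup X] [Module ℚ X]
    (τ : Representation ℚ (Equiv.Perm (Fin (k + ℓ))) X) (ψ : X →ₗ[ℚ] V)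
    (hψ : ∀ g x, ψ (τ (youngHom k ℓ g) x) = ρ g.1 (ψ x)) (x : X) :
    indProj ρ ℓ (indLift ρ ℓ τ ψ x) =
      (Fintype.card (Equiv.Perm (Fin k) × Equiv.Perm (Fin ℓ)) : ℚ) • ψ x := by
  rw [indLift_apply, map_sum, sum_indProj_eq ℓ _ fun σ hσ => indProj_mk_of_notMem ρ ℓ hσ _]
  rw [Finset.sum_congr rfl fun g _ => by
    rw [indProj_mk_youngHom, hψ, ← Module.End.mul_apply, ← map_mul, inv_mul_cancel, map_one,
      Module.End.one_apply]]
  rw [Finset.sum_const, Finset.card_univ, Nat.cast_smul_eq_nsmul]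

theorem indLift_indProj (x : IndSpace ρ ℓ) :
    indLift ρ ℓ (indRep ρ ℓ) (indProj ρ ℓ) x =
      (Fintype.card (Equiv.Perm (Fin k) × Equiv.Perm (Fin ℓ)) : ℚ) • x := by
  suffices indLift ρ ℓ (indRep ρ ℓ) (indProj ρ ℓ) =
      (Fintype.card (Equiv.Perm (Fin k) × Equiv.Perm (Fin ℓ)) : ℚ) • LinearMap.id from
    LinearMap.congr_fun this x
  refine ind_hom_ext ρ ℓ fun τ v => ?_
  rw [indLift_apply, ← Equiv.sum_comp (Equiv.mulRight τ),
    sum_indProj_eq ℓ]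
  · rw [LinearMap.smul_apply, LinearMap.id_apply, ← Finset.card_univ, Nat.cast_smul_eq_nsmul,
      ← Finset.sum_const]
    refine Finset.sum_congr rfl fun g _ => ?_
    rw [Equiv.coe_mulRight, indRep_indMk, mul_inv_rev, mul_inv_cancel_left, ← map_inv,
      indProj_mk_youngHom, Prod.fst_inv, inv_inv, indMk_youngHom_mul]
  · intro σ hσ
    rw [Equiv.coe_mulRight, indRep_indMk, mul_inv_rev, mul_inv_cancel_left,
      indProj_mk_of_notMem]
    · exact map_zero _
    · rwa [Subgroup.inv_mem_iff]

/-- Up to a nonzero factor, x is the average that `indLift` builds from its components. -/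
theorem ind_eq_zero {x : IndSpace ρ ℓ} (h : ∀ σ, indProj ρ ℓ (indRep ρ ℓ σ x) = 0) : x = 0 := by
  have h1 := indLift_indProj ρ ℓ x
  rw [indLift_apply, Finset.sum_eq_zero fun σ _ => by rw [h]; exact map_zero _] at h1
  exact (smul_eq_zero.1 h1.symm).resolve_left (Nat.cast_ne_zero.2 Fintype.card_ne_zero)

/-! ### The natural inclusion seen through the identity component -/

theorem stdHom_mem_range_iff {σ : Equiv.Perm (Fin (k + ℓ))} :
    stdHom (k + ℓ) σ ∈ (youngHom k (ℓ + 1)).range ↔ σ ∈ (youngHom k ℓ).range := by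
  constructor
  · rintro ⟨g, hg⟩
    refine mem_range_youngHom_of_forall_lt fun i hi => ?_
    have h1 := youngHom_lt g (i := i.castSucc) hi
    rw [hg] at h1
    simpa [stdHom_castSucc] using h1
  · rintro ⟨g, rfl⟩
    exact ⟨_, youngHom_stdHom g⟩

theorem indProj_indInclusion (x : IndSpace ρ ℓ) :
    indProj ρ (ℓ + 1) (indInclusion ρ ℓ x) = indProj ρ ℓ x := by
  suffices indProj ρ (ℓ + 1) ∘ₗ indInclusion ρ ℓ = indProj ρ ℓ from LinearMap.congr_fun this x
  refine ind_hom_ext ρ ℓ fun σ v => ?_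
  rw [LinearMap.comp_apply, indInclusion_mk]
  by_cases h : σ ∈ (youngHom k ℓ).range
  · obtain ⟨g, rfl⟩ := h
    rw [indProj_mk_youngHom, ← youngHom_stdHom]
    exact indProj_mk_youngHom ρ (ℓ + 1) _ v
  · rw [indProj_mk_of_notMem ρ ℓ h]
    exact indProj_mk_of_notMem ρ (ℓ + 1) (fun h' => h ((stdHom_mem_range_iff ℓ).1 h')) v

theorem indInclusion_injective : Function.Injective (indInclusion ρ ℓ) := by
  rw [injective_iff_map_eq_zero]
  intro x hx
  refine ind_eq_zero ρ ℓ fun σ => ?_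
  rw [← indProj_indInclusion, indInclusion_equivariant, hx, map_zero, map_zero]

theorem groupSpan_image_indInclusion :
    (groupSpan (indRep ρ (ℓ + 1))
      (indInclusion ρ ℓ '' ((⊤ : Submodule ℚ (IndSpace ρ ℓ)) : Set (IndSpace ρ ℓ)))).toSubmodule =
        ⊤ := by
  rw [← Submodule.ker_mkQ (groupSpan _ _).toSubmodule, LinearMap.ker_eq_top]
  refine ind_hom_ext ρ (ℓ + 1) fun σ v => ?_
  rw [LinearMap.zero_apply, Submodule.mkQ_apply, Submodule.Quotient.mk_eq_zero]
  refine Submodule.subset_span ⟨σ⁻¹, _, ⟨indMk ρ ℓ 1 v, trivial, rfl⟩, ?_⟩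
  rw [indInclusion_mk, map_one]
  refine Eq.trans ?_ (indRep_indMk ρ (ℓ + 1) σ⁻¹ 1 v).symm
  rw [one_mul, inv_inv]

/-- Swapping the last letter with the letter `j ≥ k` does not affect the identity component of the
image of the inclusion, and swapping it with the letter `j < k` kills it. -/
theorem indProj_swap_last (j : Fin (k + ℓ + 1)) (x : IndSpace ρ ℓ) :
    indProj ρ (ℓ + 1) (indRep ρ (ℓ + 1) (Equiv.swap j (Fin.last (k + ℓ)))
      (indInclusion ρ ℓ x)) = if k ≤ (j : ℕ) then indProj ρ ℓ x else 0 := by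
  split_ifs with hj
  · obtain ⟨g, hg⟩ := exists_youngHom_one (k := k) (ℓ := ℓ + 1)
      (σ := Equiv.swap j (Fin.last (k + ℓ))) fun i hi => by
        refine Equiv.swap_apply_of_ne_of_ne ?_ ?_
        · rintro rfl
          exact absurd hi (not_lt.2 hj)
        · rintro rfl
          exact absurd hi (by simp)
    rw [← hg, indProj_youngHom, indProj_indInclusion]
    simp
  · suffices indProj ρ (ℓ + 1) ∘ₗ indRep ρ (ℓ + 1) (Equiv.swap j (Fin.last (k + ℓ))) ∘ₗ
        indInclusion ρ ℓ = 0 from LinearMap.congr_fun this x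
    refine ind_hom_ext ρ ℓ fun σ v => ?_
    rw [LinearMap.comp_apply, LinearMap.comp_apply, indInclusion_mk]
    rw [indRep_indMk ρ (ℓ + 1), LinearMap.zero_apply]
    refine indProj_mk_of_notMem ρ (ℓ + 1) ?_ v
    rintro ⟨g, hg⟩
    have h1 := youngHom_lt (ℓ := ℓ + 1) g (i := j) (not_le.1 hj)
    rw [hg, Equiv.swap_inv, Equiv.Perm.mul_apply, Equiv.swap_apply_left, stdHom_last] at h1
    simp at h1

/-- The sum of the translates of the inclusion by the transpositions `(i n+1)`, `i ∈ s`. -/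
noncomputable def swapSum (s : Finset (Fin (k + ℓ + 1))) : IndSpace ρ ℓ →ₗ[ℚ] IndSpace ρ (ℓ + 1) :=
  ∑ i ∈ s, indRep ρ (ℓ + 1) (Equiv.swap i (Fin.last (k + ℓ))) ∘ₗ indInclusion ρ ℓ

/-- Since σ(i n+1) = (σi n+1)σ, the component of σ · swapSum x is the component of σx times the
number of i ∈ s with σi outside the first k letters. The last letter is fixed by σ, so it is always
counted and the factor is positive. -/
theorem swapSum_injective (s : Finset (Fin (k + ℓ + 1))) (hs : Fin.last (k + ℓ) ∈ s) :
    Function.Injective (swapSum ρ ℓ s) := by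
  rw [injective_iff_map_eq_zero]
  intro x hx
  refine ind_eq_zero ρ ℓ fun σ => ?_
  have h1 : indProj ρ (ℓ + 1) (indRep ρ (ℓ + 1) (stdHom (k + ℓ) σ) (swapSum ρ ℓ s x)) = 0 := by
    rw [hx, map_zero, map_zero]
  have h2 : ∀ i, indProj ρ (ℓ + 1) (indRep ρ (ℓ + 1) (stdHom (k + ℓ) σ)
      (indRep ρ (ℓ + 1) (Equiv.swap i (Fin.last (k + ℓ))) (indInclusion ρ ℓ x))) =
      (if k ≤ (stdHom (k + ℓ) σ i : ℕ) then (1 : ℚ) else 0) •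
        indProj ρ ℓ (indRep ρ ℓ σ x) := by
    intro i
    have e : stdHom (k + ℓ) σ * Equiv.swap i (Fin.last (k + ℓ)) =
        Equiv.swap (stdHom (k + ℓ) σ i) (Fin.last (k + ℓ)) * stdHom (k + ℓ) σ := by
      rw [Equiv.mul_swap_eq_swap_mul, stdHom_last]
    rw [← Module.End.mul_apply, ← map_mul]
    refine (congrArg (fun π => indProj ρ (ℓ + 1) (indRep ρ (ℓ + 1) π
      (indInclusion ρ ℓ x))) e).trans ?_
    refine (congrArg (fun f => indProj ρ (ℓ + 1) (f (indInclusion ρ ℓ x)))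
      (map_mul (indRep ρ (ℓ + 1)) _ _)).trans ?_
    rw [Module.End.mul_apply, ← indInclusion_equivariant, indProj_swap_last, ite_smul, one_smul,
      zero_smul]
  simp only [swapSum, LinearMap.sum_apply, LinearMap.comp_apply, map_sum] at h1
  replace h1 := (Finset.sum_congr rfl fun i _ => (h2 i).symm).trans h1
  rw [← Finset.sum_smul] at h1
  refine (smul_eq_zero.1 h1).resolve_left (ne_of_gt ?_)
  refine Finset.sum_pos' (fun i _ => by split_ifs <;> norm_num) ⟨_, hs, ?_⟩
  rw [stdHom_last, if_pos (by simp)]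
  norm_num

end Induced

/-! ### Row and column symmetrizers -/

section Symmetrizers

theorem eq_zero_of_eq_neg {X : Type*} [AddCommGroup X] [Module ℚ X] {x : X} (h : x = -x) :
    x = 0 := by
  have h1 : (2 : ℚ) • x = 0 := by rw [two_smul, ← eq_neg_iff_add_eq_zero]; exact h
  exact (smul_eq_zero.1 h1).resolve_left two_ne_zero

variable {μ : YoungDiagram} {n : ℕ} (T : Tableau μ n)
  {X Y : Type*} [AddCommGroup X] [Module ℚ X] [AddCommGroup Y] [Module ℚ Y]
  (ρ : Representation ℚ (Equiv.Perm (Fin n)) X) (τ : Representation ℚ (Equiv.Perm (Fin n)) Y)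

theorem Tabloid.mk_eq_mk {T S : Tableau μ n} :
    Tabloid.mk T = Tabloid.mk S ↔ ∀ x, T.rowOf x = S.rowOf x :=
  Quotient.eq (r := Tableau.rowSetoid μ n)

theorem Tabloid.smul_mk_eq_self {T : Tableau μ n} {σ : Equiv.Perm (Fin n)} :
    σ • Tabloid.mk T = Tabloid.mk T ↔ ∀ x, T.rowOf (σ x) = T.rowOf x := by
  rw [Tabloid.smul_mk, Tabloid.mk_eq_mk]
  simp only [Tableau.rowOf_smul]
  refine ⟨fun h x => ?_, fun h x => ?_⟩
  · simpa using (h (σ x)).symm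
  · simpa using (h (σ⁻¹ x)).symm

instance : Finite (Tabloid μ n) := inferInstanceAs (Finite (Quotient (Tableau.rowSetoid μ n)))

theorem Tableau.exists_smul_eq (T S : Tableau μ n) : ∃ σ : Equiv.Perm (Fin n), σ • T = S :=
  ⟨T.symm.trans S, by ext c; simp [Tableau.smul_apply]⟩

open Classical in
/-- The row symmetrizer of `T` acting on a representation. -/
noncomputable def rowSym : X →ₗ[ℚ] X :=
  ∑ σ : Equiv.Perm (Fin n) with σ • Tabloid.mk T = Tabloid.mk T, ρ σ

/-- The signed column symmetrizer of `T` acting on a representation. -/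
noncomputable def colSym : X →ₗ[ℚ] X :=
  ∑ q : T.colStab, ((Equiv.Perm.sign (q : Equiv.Perm (Fin n)) : ℤ) : ℚ) • ρ q

theorem colSym_apply (x : X) : colSym T ρ x =
    ∑ q : T.colStab, ((Equiv.Perm.sign (q : Equiv.Perm (Fin n)) : ℤ) : ℚ) • ρ q x := by
  simp [colSym]

open Classical in
theorem rowSym_apply (x : X) : rowSym T ρ x =
    ∑ σ : Equiv.Perm (Fin n) with σ • Tabloid.mk T = Tabloid.mk T, ρ σ x := by
  simp [rowSym]

theorem map_colSym (f : X →ₗ[ℚ] Y) (hf : ∀ σ x, f (ρ σ x) = τ σ (f x)) (x : X) :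
    f (colSym T ρ x) = colSym T τ (f x) := by
  simp only [colSym_apply, map_sum, map_smul, hf]

theorem map_rowSym (f : X →ₗ[ℚ] Y) (hf : ∀ σ x, f (ρ σ x) = τ σ (f x)) (x : X) :
    f (rowSym T ρ x) = rowSym T τ (f x) := by
  simp only [rowSym_apply, map_sum, hf]

theorem colSym_mem (W : Subrepresentation ρ) {x : X} (hx : x ∈ W.toSubmodule) :
    colSym T ρ x ∈ W.toSubmodule := by
  rw [colSym_apply]
  exact Submodule.sum_mem _ fun q _ => Submodule.smul_mem _ _ (W.apply_mem_toSubmodule _ hx)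

theorem colSym_map_of_mem {q : Equiv.Perm (Fin n)} (hq : q ∈ T.colStab) (x : X) :
    colSym T ρ (ρ q x) = ((Equiv.Perm.sign q : ℤ) : ℚ) • colSym T ρ x := by
  rw [colSym_apply, colSym_apply, Finset.smul_sum]
  refine Fintype.sum_equiv (Equiv.mulRight (⟨q, hq⟩ : T.colStab)) _ _ fun p => ?_
  rw [Equiv.coe_mulRight, Subgroup.coe_mul, map_mul, map_mul, Module.End.mul_apply, smul_smul,
    mul_comm (Equiv.Perm.sign _), Units.val_mul, Int.cast_mul, ← mul_assoc, ← Int.cast_mul,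
    ← Units.val_mul, Int.units_mul_self, Units.val_one, Int.cast_one, one_mul]

theorem map_colSym_of_mem {q : Equiv.Perm (Fin n)} (hq : q ∈ T.colStab) (x : X) :
    ρ q (colSym T ρ x) = ((Equiv.Perm.sign q : ℤ) : ℚ) • colSym T ρ x := by
  rw [colSym_apply, map_sum, Finset.smul_sum]
  refine Fintype.sum_equiv (Equiv.mulLeft (⟨q, hq⟩ : T.colStab)) _ _ fun p => ?_
  rw [Equiv.coe_mulLeft, Subgroup.coe_mul, map_mul, map_mul, Module.End.mul_apply, smul_smul,
    Units.val_mul, Int.cast_mul, ← mul_assoc, ← Int.cast_mul, ← Units.val_mul,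
    Int.units_mul_self, Units.val_one, Int.cast_one, one_mul, map_smul]

theorem colSym_colSym (x : X) :
    colSym T ρ (colSym T ρ x) = (Fintype.card T.colStab : ℚ) • colSym T ρ x := by
  nth_rw 2 [colSym_apply]
  simp only [map_sum, map_smul]
  rw [Finset.sum_congr rfl fun q _ => by
    rw [colSym_map_of_mem T ρ q.2, smul_smul, ← Int.cast_mul, ← Units.val_mul,
      Int.units_mul_self, Units.val_one, Int.cast_one, one_smul]]
  rw [Finset.sum_const, Finset.card_univ, Nat.cast_smul_eq_nsmul]

theorem map_rowSym_of_smul_eq {σ : Equiv.Perm (Fin n)} (hσ : σ • Tabloid.mk T = Tabloid.mk T)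
    (x : X) : ρ σ (rowSym T ρ x) = rowSym T ρ x := by
  classical
  rw [rowSym_apply, map_sum]
  refine Finset.sum_equiv (Equiv.mulLeft σ) (fun π => ?_) fun π _ => ?_
  · simp only [Finset.mem_filter_univ, Equiv.coe_mulLeft, mul_smul]
    refine ⟨fun h => by rw [h, hσ], fun h => ?_⟩
    rw [← inv_smul_smul σ (π • Tabloid.mk T), h, inv_smul_eq_iff, hσ]
  · rw [Equiv.coe_mulLeft, map_mul, Module.End.mul_apply]

open Classical in
theorem rowSym_rowSym (x : X) : rowSym T ρ (rowSym T ρ x) =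
    (Finset.card {σ : Equiv.Perm (Fin n) | σ • Tabloid.mk T = Tabloid.mk T} : ℚ) •
      rowSym T ρ x := by
  rw [rowSym_apply T ρ (rowSym T ρ x)]
  rw [Finset.sum_congr rfl fun σ hσ => map_rowSym_of_smul_eq T ρ (Finset.mem_filter.1 hσ).2 x,
    Finset.sum_const, Nat.cast_smul_eq_nsmul]

open Classical in
/-- The equivariant map from `M^μ` that sends the tabloid of `T` to `rowSym T ρ y`. -/
noncomputable def tabloidLift (y : X) : ℚ[Tabloid μ n] →ₗ[ℚ] X :=
  linExt fun t => ∑ σ : Equiv.Perm (Fin n) with σ • Tabloid.mk T = t, ρ σ y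

theorem tabloidLift_equivariant (y : X) (σ : Equiv.Perm (Fin n)) (v : ℚ[Tabloid μ n]) :
    tabloidLift T ρ y (tabloidRep μ n σ v) = ρ σ (tabloidLift T ρ y v) := by
  classical
  suffices tabloidLift T ρ y ∘ₗ tabloidRep μ n σ = ρ σ ∘ₗ tabloidLift T ρ y from
    LinearMap.congr_fun this v
  refine linear_ext_single fun t => ?_
  rw [LinearMap.comp_apply, LinearMap.comp_apply, Representation.ofMulAction_single, tabloidLift,
    linExt_single, linExt_single, one_smul, one_smul, map_sum]
  symm
  refine Finset.sum_equiv (Equiv.mulLeft σ) (fun π => ?_) fun π _ => ?_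
  · simp [mul_smul]
  · rw [Equiv.coe_mulLeft, map_mul, Module.End.mul_apply]

theorem polytabloid_eq_colSym :
    polytabloid T = colSym T (tabloidRep μ n) (MonoidAlgebra.single (Tabloid.mk T) 1) := by
  rw [colSym_apply, polytabloid]
  refine Finset.sum_congr rfl fun q _ => ?_
  rw [Representation.ofMulAction_single, Tabloid.smul_mk, MonoidAlgebra.smul_single, smul_eq_mul,
    mul_one]

theorem tabloidLift_polytabloid (y : X) :
    tabloidLift T ρ y (polytabloid T) = colSym T ρ (rowSym T ρ y) := by
  rw [polytabloid_eq_colSym, map_colSym T _ ρ _ (tabloidLift_equivariant T ρ y), tabloidLift,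
    linExt_single, one_smul, rowSym_apply]

/-! ### Invariant forms -/

/-- A finite-dimensional rational representation of a finite group has an invariant anisotropic
bilinear form. -/
theorem exists_invariant_form {G : Type*} [Group G] [Finite G] [FiniteDimensional ℚ X]
    (ρ : Representation ℚ G X) : ∃ B : X →ₗ[ℚ] X →ₗ[ℚ] ℚ,
      (∀ g x y, B (ρ g x) (ρ g y) = B x y) ∧ ∀ x, B x x = 0 → x = 0 := by
  classical
  have := Fintype.ofFinite G
  let b := Module.finBasis ℚ X
  let B₀ : X →ₗ[ℚ] X →ₗ[ℚ] ℚ := ∑ i, (LinearMap.mul ℚ ℚ).compl₁₂ (b.coord i) (b.coord i)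
  have hB₀ : ∀ x y, B₀ x y = ∑ i, b.repr x i * b.repr y i := fun x y => by
    simp [B₀, LinearMap.sum_apply]
  have hnn : ∀ x, 0 ≤ B₀ x x := fun x => by
    rw [hB₀]; exact Finset.sum_nonneg fun i _ => mul_self_nonneg _
  refine ⟨∑ g, B₀.compl₁₂ (ρ g) (ρ g), fun g x y => ?_, fun x hx => ?_⟩
  · simp only [LinearMap.sum_apply, LinearMap.compl₁₂_apply]
    refine Fintype.sum_equiv (Equiv.mulRight g) _ _ fun h => ?_
    simp
  · simp only [LinearMap.sum_apply, LinearMap.compl₁₂_apply] at hx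
    have h1 := (Finset.sum_eq_zero_iff_of_nonneg fun g _ => hnn (ρ g x)).1 hx 1
      (Finset.mem_univ _)
    rw [map_one, Module.End.one_apply, hB₀,
      Finset.sum_eq_zero_iff_of_nonneg fun i _ => mul_self_nonneg _] at h1
    refine b.repr.map_eq_zero_iff.1 (Finsupp.ext fun i => ?_)
    simpa using h1 i (Finset.mem_univ _)

theorem form_apply_left {G : Type*} [Group G] {ρ : Representation ℚ G X} {B : X →ₗ[ℚ] X →ₗ[ℚ] ℚ}
    (hB : ∀ g x y, B (ρ g x) (ρ g y) = B x y) (g : G) (x y : X) :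
    B (ρ g x) y = B x (ρ g⁻¹ y) := by
  rw [← hB g⁻¹ (ρ g x) y, ← Module.End.mul_apply, ← map_mul]
  simp

variable {ρ} in
theorem form_colSym {B : X →ₗ[ℚ] X →ₗ[ℚ] ℚ} (hB : ∀ g x y, B (ρ g x) (ρ g y) = B x y)
    (x y : X) : B (colSym T ρ x) y = B x (colSym T ρ y) := by
  simp only [colSym_apply, map_sum, LinearMap.sum_apply, map_smul, LinearMap.smul_apply]
  refine Fintype.sum_equiv (Equiv.inv _) _ _ fun q => ?_
  rw [form_apply_left hB]
  simp

variable {ρ} in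
theorem form_rowSym {B : X →ₗ[ℚ] X →ₗ[ℚ] ℚ} (hB : ∀ g x y, B (ρ g x) (ρ g y) = B x y)
    (x y : X) : B (rowSym T ρ x) y = B x (rowSym T ρ y) := by
  classical
  simp only [rowSym_apply, map_sum, LinearMap.sum_apply]
  refine Finset.sum_equiv (Equiv.inv _) (fun σ => ?_) fun σ _ => ?_
  · simp only [Finset.mem_filter_univ, Equiv.inv_apply, inv_smul_eq_iff]
    exact eq_comm
  · rw [form_apply_left hB]
    simp

/-- Both symmetrizers R and C are self-adjoint and R² = rR with r a number, so B(RCx, RCx) = r B(x,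
CRCx) = 0 for an invariant anisotropic form B. -/
theorem rowSym_colSym_eq_zero [FiniteDimensional ℚ X] {x : X}
    (h : colSym T ρ (rowSym T ρ (colSym T ρ x)) = 0) : rowSym T ρ (colSym T ρ x) = 0 := by
  obtain ⟨B, hB, h0⟩ := exists_invariant_form ρ
  apply h0
  rw [form_rowSym T hB, rowSym_rowSym, map_smul, form_colSym T hB, h, map_zero, smul_zero]

/-! ### Specht modules -/

/-- A polytabloid as an element of the Specht module. -/
noncomputable def spechtVec : (specht μ n).toSubmodule :=
  ⟨polytabloid T, Submodule.subset_span ⟨T, rfl⟩⟩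

theorem specht_spechtVec (σ : Equiv.Perm (Fin n)) :
    (specht μ n).toRepresentation σ (spechtVec T) = spechtVec (σ • T) :=
  Subtype.ext (tabloidRep_polytabloid σ T)

theorem specht_hom_ext {f g : (specht μ n).toSubmodule →ₗ[ℚ] X}
    (h : ∀ T, f (spechtVec T) = g (spechtVec T)) : f = g := by
  refine LinearMap.ext fun ⟨v, hv⟩ => ?_
  induction hv using Submodule.span_induction with
  | mem v hv =>
    obtain ⟨T, rfl⟩ := hv
    exact h T
  | zero => exact (map_zero f).trans (map_zero g).symm
  | add x y hx hy h1 h2 =>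
    have := congrArg₂ (· + ·) h1 h2
    rw [← map_add, ← map_add] at this
    exact this
  | smul a x hx h1 =>
    have := congrArg (a • ·) h1
    simp only [← map_smul] at this
    exact this

/-- S_n is transitive on tableaux, so a single polytabloid generates the Specht module. -/
theorem specht_hom_eq_zero {f : (specht μ n).toSubmodule →ₗ[ℚ] X}
    (hf : ∀ σ x, f ((specht μ n).toRepresentation σ x) = ρ σ (f x))
    (h : f (spechtVec T) = 0) : f = 0 := by
  refine specht_hom_ext fun S => ?_
  obtain ⟨σ, rfl⟩ := T.exists_smul_eq S
  rw [← specht_spechtVec, hf, h, map_zero, LinearMap.zero_apply]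

/-! ### Symmetrizers on the Specht module -/

/-- A label's box is determined by its row and its column. -/
theorem smul_tabloid_of_mem_colStab {q : Equiv.Perm (Fin n)} (hq : q ∈ T.colStab)
    (h : q • Tabloid.mk T = Tabloid.mk T) : q = 1 := by
  rw [Tabloid.smul_mk_eq_self] at h
  ext x
  congr 1
  apply T.symm.injective
  exact Subtype.ext (Prod.ext (h x) (hq x))

theorem coeff_polytabloid_self : (polytabloid T).coeff (Tabloid.mk T) = 1 := by
  classical
  rw [polytabloid, MonoidAlgebra.coeff_sum, Finsupp.finsetSum_apply,
    Finset.sum_eq_single 1]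
  · simp
  · intro q _ hq
    rw [MonoidAlgebra.coeff_single, Finsupp.single_apply, if_neg]
    intro h
    exact hq (Subtype.ext (smul_tabloid_of_mem_colStab T q.2 h))
  · simp

theorem spechtVec_ne_zero : spechtVec T ≠ 0 := by
  intro h
  have h1 : polytabloid T = 0 := congrArg Subtype.val h
  have h2 := coeff_polytabloid_self T
  rw [h1] at h2
  simp at h2

/-- The coefficient at the tabloid of T is the order of the row group: every σ in that group fixes
this tabloid, where the polytabloid has coefficient 1. -/
theorem rowSym_spechtVec_ne_zero :
    rowSym T (specht μ n).toRepresentation (spechtVec T) ≠ 0 := by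
  classical
  intro h
  have h1 := map_rowSym T (specht μ n).toRepresentation (tabloidRep μ n)
      (specht μ n).toSubmodule.subtype
    (fun σ x => rfl) (spechtVec T)
  rw [h, map_zero] at h1
  have h2 := congrArg (fun v : ℚ[Tabloid μ n] => v.coeff (Tabloid.mk T)) h1
  simp only [rowSym_apply, MonoidAlgebra.coeff_sum, Finsupp.finsetSum_apply] at h2
  rw [Finset.sum_congr rfl fun σ hσ => by
    rw [Representation.coeff_ofMulAction, inv_smul_eq_iff.2 (Finset.mem_filter.1 hσ).2.symm,
      Submodule.subtype_apply, spechtVec, coeff_polytabloid_self T]] at h2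
  rw [Finset.sum_const, nsmul_eq_mul, mul_one] at h2
  have h3 : (1 : Equiv.Perm (Fin n)) ∈
      ({σ | σ • Tabloid.mk T = Tabloid.mk T} : Finset (Equiv.Perm (Fin n))) := by simp
  have h4 : Finset.card ({σ | σ • Tabloid.mk T = Tabloid.mk T} : Finset (Equiv.Perm (Fin n))) = 0 := by
    simpa using h2.symm
  rw [Finset.card_eq_zero.1 h4] at h3
  simp at h3

/-- If no two labels in the same column of `T` lie in the same row of `S`, then the tabloid of `S`
is obtained from that of `T` by a column permutation. -/
theorem exists_mem_colStab_smul_mk_eq (S : Tableau μ n)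
    (h : ∀ x y, T.colOf x = T.colOf y → S.rowOf x = S.rowOf y → x = y) :
    ∃ q ∈ T.colStab, q • Tabloid.mk T = Tabloid.mk S := by
  -- Each column of T is sorted by the rows of S: x moves to the row numbered by how many labels of
  -- its column lie higher in S. The resulting tableau is `T₁`.
  let before (x : Fin n) : Finset (Fin n) :=
    {y | T.colOf y = T.colOf x ∧ S.rowOf y < S.rowOf x}
  have hmem : ∀ x, ((before x).card, T.colOf x) ∈ μ.cells := fun x => by
    rw [YoungDiagram.mem_cells, YoungDiagram.mem_iff_lt_colLen, YoungDiagram.colLen_eq_card]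
    calc (before x).card < ({y | T.colOf y = T.colOf x} : Finset (Fin n)).card := by
          refine Finset.card_lt_card (Finset.ssubset_iff_of_subset ?_ |>.2 ⟨x, ?_, ?_⟩)
          · intro y; simp +contextual [before]
          · simp
          · simp [before]
      _ ≤ (μ.col (T.colOf x)).card := by
          refine Finset.card_le_card_of_injOn (fun y => (T.symm y).1) (fun y hy => ?_)
            fun y _ z _ hyz => T.symm.injective (Subtype.ext hyz)
          rw [Finset.mem_coe, Finset.mem_filter] at hy
          exact YoungDiagram.mem_col_iff.2 ⟨(T.symm y).2, hy.2⟩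
  have hlt : ∀ x y, T.colOf x = T.colOf y → S.rowOf x < S.rowOf y →
      (before x).card < (before y).card := fun x y hc hr => by
    refine Finset.card_lt_card (Finset.ssubset_iff_of_subset ?_ |>.2 ⟨x, ?_, ?_⟩)
    · intro z
      simp only [before, Finset.mem_filter_univ]
      exact fun hz => ⟨hz.1.trans hc, hz.2.trans hr⟩
    · simp [before, hc, hr]
    · simp [before]
  let r : Fin n → μ.cells := fun x => ⟨_, hmem x⟩
  have hr : Function.Injective r := fun x y hxy => by
    have h1 : (before x).card = (before y).card := congrArg (fun c => c.1.1) hxy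
    have h2 : T.colOf x = T.colOf y := congrArg (fun c => c.1.2) hxy
    refine h x y h2 (le_antisymm ?_ ?_)
    · exact not_lt.1 fun h3 => (hlt y x h2.symm h3).ne' h1
    · exact not_lt.1 fun h3 => (hlt x y h2 h3).ne h1
  have hrb : Function.Bijective r :=
    (Fintype.bijective_iff_injective_and_card r).2 ⟨hr, Fintype.card_congr T.symm⟩
  let T₁ : Tableau μ n := (Equiv.ofBijective r hrb).symm
  have hle : ∀ x, T₁.rowOf x ≤ S.rowOf x := fun x => by
    change (before x).card ≤ _
    rw [← Finset.card_range (S.rowOf x)]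
    refine Finset.card_le_card_of_injOn S.rowOf (fun y hy => ?_) fun y hy z hz hyz => ?_
    · simp only [before, Finset.coe_filter, Finset.mem_univ, true_and, Set.mem_ofPred_eq] at hy
      simpa using hy.2
    · simp only [before, Finset.coe_filter, Finset.mem_univ, true_and, Set.mem_ofPred_eq] at hy hz
      exact h y z (hy.1.trans hz.1.symm) hyz
  -- No label is lower in `T₁` than in S, and both sums run over the boxes of μ, so all the
  -- inequalities are equalities.
  have hsum : ∑ x, T₁.rowOf x = ∑ x, S.rowOf x :=
    (Equiv.sum_comp T₁.symm fun c => c.1.1).trans (Equiv.sum_comp S.symm fun c => c.1.1).symm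
  have heq := (Finset.sum_eq_sum_iff_of_le fun x _ => hle x).1 hsum
  obtain ⟨q, hq⟩ := T.exists_smul_eq T₁
  refine ⟨q, fun x => ?_, ?_⟩
  · have h1 : T₁.colOf (q x) = T.colOf x := by rw [← hq, Tableau.colOf_smul]; simp
    exact h1
  · rw [Tabloid.smul_mk, hq, Tabloid.mk_eq_mk]
    exact fun x => heq x (Finset.mem_univ x)

/-- A tabloid {S} is either a column translate of {T}, with image ± the polytabloid of T, or it is
fixed by a transposition in the column group, and then its image equals its own negative. -/
theorem colSym_mem_span (v : ℚ[Tabloid μ n]) :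
    colSym T (tabloidRep μ n) v ∈ Submodule.span ℚ {polytabloid T} := by
  suffices (Submodule.span ℚ {polytabloid T}).mkQ ∘ₗ colSym T (tabloidRep μ n) = 0 by
    rw [← Submodule.Quotient.mk_eq_zero]
    exact LinearMap.congr_fun this v
  refine linear_ext_single fun t => ?_
  rw [LinearMap.comp_apply, LinearMap.zero_apply, Submodule.mkQ_apply,
    Submodule.Quotient.mk_eq_zero]
  induction t using Quotient.inductionOn with | h S => ?_
  change colSym T _ (MonoidAlgebra.single (Tabloid.mk S) 1) ∈ _
  by_cases h : ∀ x y, T.colOf x = T.colOf y → S.rowOf x = S.rowOf y → x = y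
  · obtain ⟨q, hq, hS⟩ := exists_mem_colStab_smul_mk_eq T S h
    rw [← hS, ← Representation.ofMulAction_single, colSym_map_of_mem T _ hq,
      ← polytabloid_eq_colSym]
    exact Submodule.smul_mem _ _ (Submodule.mem_span_singleton_self _)
  · push Not at h
    obtain ⟨x, y, hc, hr, hxy⟩ := h
    have hq : Equiv.swap x y ∈ T.colStab := fun z => by
      rw [Equiv.swap_apply_def]; split_ifs with h1 h2
      · rw [h1, hc]
      · rw [h2, hc]
      · rfl
    have hS : Equiv.swap x y • Tabloid.mk S = Tabloid.mk S :=
      Tabloid.smul_mk_eq_self.2 fun z => by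
        rw [Equiv.swap_apply_def]; split_ifs with h1 h2
        · rw [h1, hr]
        · rw [h2, hr]
        · rfl
    have h1 := colSym_map_of_mem T (tabloidRep μ n) hq (MonoidAlgebra.single (Tabloid.mk S) 1)
    rw [Representation.ofMulAction_single, hS, Equiv.Perm.sign_swap hxy] at h1
    simp only [Units.val_neg, Units.val_one, Int.cast_neg, Int.cast_one, neg_smul, one_smul] at h1
    rw [eq_zero_of_eq_neg h1]
    exact Submodule.zero_mem _

theorem exists_colSym_spechtVec (v : (specht μ n).toSubmodule) :
    ∃ c : ℚ, colSym T (specht μ n).toRepresentation v = c • spechtVec T := by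
  obtain ⟨c, hc⟩ := Submodule.mem_span_singleton.1 (colSym_mem_span T v.1)
  refine ⟨c, Subtype.ext ?_⟩
  refine (map_colSym T (specht μ n).toRepresentation (tabloidRep μ n)
      (specht μ n).toSubmodule.subtype
    (fun σ x => rfl) v).trans hc.symm

/-- If C_T v = 0 for all T, then B(v, v_T) = B(C_T v, {T}) = 0, so v is orthogonal to the Specht
module that contains it. -/
theorem exists_colSym_ne_zero {v : (specht μ n).toSubmodule} (hv : v ≠ 0) :
    ∃ T : Tableau μ n, colSym T (specht μ n).toRepresentation v ≠ 0 := by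
  have : Module.Finite ℚ ℚ[Tabloid μ n] :=
    Module.Finite.equiv (MonoidAlgebra.coeffLinearEquiv ℚ).symm
  by_contra! h
  obtain ⟨B, hB, h0⟩ := exists_invariant_form (tabloidRep μ n)
  have h1 : ∀ T, B v.1 (polytabloid T) = 0 := fun T => by
    have h2 := map_colSym T (specht μ n).toRepresentation (tabloidRep μ n)
      (specht μ n).toSubmodule.subtype
      (fun σ x => rfl) v
    rw [h T, map_zero] at h2
    rw [polytabloid_eq_colSym, ← form_colSym T hB]
    refine (congrArg (fun w => B w _) h2.symm).trans ?_
    simp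
  have h3 : ∀ w ∈ (specht μ n).toSubmodule, B v.1 w = 0 := fun w hw => by
    have : (specht μ n).toSubmodule ≤ LinearMap.ker (B v.1) := by
      refine Submodule.span_le.2 ?_
      rintro _ ⟨T, rfl⟩
      exact h1 T
    exact this hw
  exact hv (Subtype.ext (h0 _ (h3 v.1 v.2)))

/-! ### Copies of Specht modules -/

theorem IsCopies.exists_homs {W : Subrepresentation ρ} {m : ℕ}
    (hW : IsCopies W (specht μ n).toRepresentation m) :
    ∃ f : Fin m → (specht μ n).toSubmodule →ₗ[ℚ] X,
      (∀ i σ x, f i ((specht μ n).toRepresentation σ x) = ρ σ (f i x)) ∧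
      (∀ i x, f i x ∈ W.toSubmodule) ∧
      ∀ x, x ≠ 0 → LinearIndependent ℚ fun i => f i x := by
  classical
  obtain ⟨e⟩ := hW
  refine ⟨fun i => W.toSubmodule.subtype ∘ₗ e.symm.toLinearMap ∘ₗ
    DirectSum.lof ℚ (Fin m) (fun _ => (specht μ n).toSubmodule) i, fun i σ x => ?_, fun i x => ?_,
    fun x hx => ?_⟩
  · have h1 : DirectSum.lof ℚ (Fin m) (fun _ => (specht μ n).toSubmodule) i
        ((specht μ n).toRepresentation σ x) =
        Representation.directSum (fun _ : Fin m => (specht μ n).toRepresentation) σ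
          (DirectSum.lof ℚ (Fin m) (fun _ => (specht μ n).toSubmodule) i x) := by
      simp [Representation.directSum]
    simp only [LinearMap.comp_apply]
    rw [h1]
    have h2 := LinearMap.congr_fun (e.symm.isIntertwining' σ)
      (DirectSum.lof ℚ (Fin m) (fun _ => (specht μ n).toSubmodule) i x)
    exact congrArg Subtype.val h2
  · exact Subtype.prop _
  · rw [Fintype.linearIndependent_iff]
    intro c hc i
    have h1 : e.symm.toLinearMap (∑ i, c i • DirectSum.lof ℚ (Fin m)
        (fun _ => (specht μ n).toSubmodule) i x) = 0 := by
      apply Subtype.ext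
      rw [map_sum]
      simpa using hc
    have h2 := (map_eq_zero_iff e.symm e.symm.injective).1 h1
    have h3 := congrArg (fun z => DirectSum.component ℚ (Fin m) _ i z) h2
    simp only [map_sum, map_smul, map_zero, DirectSum.component.of] at h3
    rw [Finset.sum_eq_single i] at h3
    · simpa [hx] using h3
    · intro j _ hj
      simp [hj]
    · simp

/-- Independent homs have a direct sum of images because column symmetrizers project the Specht
module to lines: applying C_T to a relation ∑ f_i(z_i) = 0 turns it into ∑ c_i f_i(v_T) = 0, which
is a relation among the f_i themselves. -/
theorem exists_isCopies {m : ℕ} (f : Fin m → (specht μ n).toSubmodule →ₗ[ℚ] X)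
    (hf : ∀ i σ x, f i ((specht μ n).toRepresentation σ x) = ρ σ (f i x))
    (hli : LinearIndependent ℚ f) (Y : Subrepresentation ρ)
    (hY : ∀ i T, f i (spechtVec T) ∈ Y.toSubmodule) :
    ∃ U : Subrepresentation ρ, U ≤ Y ∧ IsCopies U (specht μ n).toRepresentation m := by
  classical
  let F : (DirectSum (Fin m) fun _ => (specht μ n).toSubmodule) →ₗ[ℚ] X :=
    ∑ i, f i ∘ₗ DirectSum.component ℚ (Fin m) _ i
  have hF : ∀ z, F z = ∑ i, f i (z i) := fun z => by
    simp only [F, LinearMap.sum_apply, LinearMap.comp_apply]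
    rfl
  have hFi : ∀ σ z, F (Representation.directSum
      (fun _ : Fin m => (specht μ n).toRepresentation) σ z) = ρ σ (F z) := fun σ z => by
    rw [hF, hF, map_sum]
    refine Finset.sum_congr rfl fun i _ => ?_
    rw [← hf]
    exact congrArg (f i) (DirectSum.lmap_apply _ _ _)
  have hinj : Function.Injective F := by
    rw [injective_iff_map_eq_zero]
    intro z hz
    refine DFinsupp.ext fun i => ?_
    by_contra hi
    -- T is chosen to detect the component z_i, so the coefficient c_i would have to be nonzero.
    obtain ⟨T, hT⟩ := exists_colSym_ne_zero hi
    choose c hc using fun j => exists_colSym_spechtVec T (z j)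
    have h1 : ∑ j, c j • f j (spechtVec T) = 0 := by
      rw [hF] at hz
      have h2 := congrArg (colSym T ρ) hz
      rw [map_zero, map_sum] at h2
      rw [← h2]
      refine Finset.sum_congr rfl fun j _ => ?_
      rw [← map_colSym T _ ρ (f j) (hf j), hc, map_smul]
    have h3 : ∑ j, c j • f j = 0 := by
      refine specht_hom_eq_zero T ρ (fun σ x => ?_) (by simpa [LinearMap.sum_apply] using h1)
      simp [LinearMap.sum_apply, hf]
    have h4 := Fintype.linearIndependent_iff.1 hli c h3 i
    apply hT
    have := hc i
    rw [h4, zero_smul] at this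
    exact this
  refine ⟨⟨LinearMap.range F, ?_⟩, ?_, ⟨(Representation.Equiv.mk
    (LinearEquiv.ofInjective F hinj) fun σ => ?_).symm⟩⟩
  · rintro σ _ ⟨z, rfl⟩
    exact ⟨_, hFi σ z⟩
  · rintro _ ⟨z, rfl⟩
    rw [hF]
    refine Submodule.sum_mem _ fun i _ => ?_
    have h5 : Y.toSubmodule.mkQ ∘ₗ f i = 0 := specht_hom_ext fun T => by
      rw [LinearMap.comp_apply, LinearMap.zero_apply, Submodule.mkQ_apply,
        Submodule.Quotient.mk_eq_zero]
      exact hY i T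
    exact (Submodule.Quotient.mk_eq_zero _).1 (LinearMap.congr_fun h5 (z i))
  · refine LinearMap.ext fun z => Subtype.ext ?_
    exact hFi σ z

end Symmetrizers

/-! ### Adding a box that is alone in its column -/

/-- The diagram `μ'` arises from `μ` by adding the box `c₀`, which is alone in its column. -/
structure AddsColumn (μ μ' : YoungDiagram) (c₀ : ℕ × ℕ) : Prop where
  cells_eq : μ'.cells = insert c₀ μ.cells
  col_ne : ∀ c ∈ μ.cells, c.2 ≠ c₀.2

namespace AddsColumn

variable {μ μ' : YoungDiagram} {c₀ : ℕ × ℕ} (h : AddsColumn μ μ' c₀) {n : ℕ} (T : Tableau μ n)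

theorem eq_of_col_eq (h : AddsColumn μ μ' c₀) {c : ℕ × ℕ} (hc : c ∈ μ'.cells)
    (hcol : c.2 = c₀.2) : c = c₀ := by
  rw [h.cells_eq, Finset.mem_insert] at hc
  exact hc.resolve_right fun h' => h.col_ne c h' hcol

/-- The box of the label `x` in the extended tableau. -/
def extendBox : Fin (n + 1) → μ'.cells :=
  Fin.lastCases ⟨c₀, by rw [h.cells_eq]; exact Finset.mem_insert_self _ _⟩
    fun x => ⟨(T.symm x).1, by rw [h.cells_eq]; exact Finset.mem_insert_of_mem (T.symm x).2⟩

theorem extendBox_bijective : Function.Bijective (h.extendBox T) := by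
  refine (Fintype.bijective_iff_injective_and_card _).2 ⟨fun x y hxy => ?_, ?_⟩
  · induction x using Fin.lastCases with
    | last =>
      induction y using Fin.lastCases with
      | last => rfl
      | cast y =>
        simp only [extendBox, Fin.lastCases_last, Fin.lastCases_castSucc, Subtype.mk.injEq] at hxy
        exact absurd (congrArg Prod.snd hxy.symm) (h.col_ne _ (T.symm y).2)
    | cast x =>
      induction y using Fin.lastCases with
      | last =>
        simp only [extendBox, Fin.lastCases_last, Fin.lastCases_castSucc, Subtype.mk.injEq] at hxy
        exact absurd (congrArg Prod.snd hxy) (h.col_ne _ (T.symm x).2)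
      | cast y =>
        simp only [extendBox, Fin.lastCases_castSucc, Subtype.mk.injEq] at hxy
        rw [T.symm.injective (Subtype.ext hxy)]
  · rw [Fintype.card_coe, h.cells_eq, Finset.card_insert_of_notMem fun h' => h.col_ne _ h' rfl,
      Fintype.card_fin, ← Fintype.card_coe, Fintype.card_congr T, Fintype.card_fin]

/-- The tableau obtained from `T` by putting the new label into the new box. -/
noncomputable def extend : Tableau μ' (n + 1) :=
  (Equiv.ofBijective _ (h.extendBox_bijective T)).symm

theorem extend_symm_last : ((h.extend T).symm (Fin.last n)).1 = c₀ := by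
  change (h.extendBox T (Fin.last n)).1 = c₀
  simp [extendBox]

theorem extend_symm_castSucc (x : Fin n) :
    ((h.extend T).symm x.castSucc).1 = (T.symm x).1 := by
  change (h.extendBox T x.castSucc).1 = _
  simp [extendBox]

theorem rowOf_extend_castSucc (x : Fin n) : (h.extend T).rowOf x.castSucc = T.rowOf x :=
  congrArg Prod.fst (h.extend_symm_castSucc T x)

theorem colOf_extend_castSucc (x : Fin n) : (h.extend T).colOf x.castSucc = T.colOf x :=
  congrArg Prod.snd (h.extend_symm_castSucc T x)

theorem rowOf_extend_last : (h.extend T).rowOf (Fin.last n) = c₀.1 :=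
  congrArg Prod.fst (h.extend_symm_last T)

theorem colOf_extend_last : (h.extend T).colOf (Fin.last n) = c₀.2 :=
  congrArg Prod.snd (h.extend_symm_last T)

theorem extend_smul (σ : Equiv.Perm (Fin n)) :
    h.extend (σ • T) = stdHom n σ • h.extend T := by
  apply Equiv.symm_bijective.injective
  ext x : 2
  change ((h.extend (σ • T)).symm x).1 = ((h.extend T).symm ((stdHom n σ)⁻¹ x)).1
  rw [← map_inv]
  induction x using Fin.lastCases with
  | last => rw [stdHom_last, extend_symm_last, extend_symm_last]
  | cast x =>
    rw [stdHom_castSucc, extend_symm_castSucc, extend_symm_castSucc]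
    rfl

theorem exists_extend_eq (hT : Nonempty (Tableau μ n)) {S : Tableau μ' (n + 1)}
    (hS : (S.symm (Fin.last n)).1 = c₀) : ∃ T, h.extend T = S := by
  obtain ⟨T⟩ := hT
  obtain ⟨σ, rfl⟩ := (h.extend T).exists_smul_eq S
  have h1 : σ⁻¹ (Fin.last n) = Fin.last n := by
    apply (h.extend T).symm.injective
    apply Subtype.ext
    rw [extend_symm_last]
    exact hS
  obtain ⟨τ, rfl⟩ := exists_stdHom_eq (Equiv.Perm.inv_eq_iff_eq.1 h1).symm
  exact ⟨τ • T, h.extend_smul T τ⟩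

theorem stdHom_mem_colStab {q : Equiv.Perm (Fin n)} :
    stdHom n q ∈ (h.extend T).colStab ↔ q ∈ T.colStab := by
  rw [Tableau.mem_colStab, Tableau.mem_colStab, Fin.forall_fin_succ']
  simp only [stdHom_castSucc, stdHom_last, colOf_extend_castSucc, and_true]

/-- The new label is alone in its column. Thus the column group of the extended tableau is the old
one, embedded in S_{n+1}. -/
theorem apply_last_of_mem_colStab {q : Equiv.Perm (Fin (n + 1))}
    (hq : q ∈ (h.extend T).colStab) : q (Fin.last n) = Fin.last n := by
  apply (h.extend T).symm.injective
  apply Subtype.ext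
  rw [extend_symm_last]
  exact h.eq_of_col_eq (Subtype.prop _) ((hq _).trans (h.colOf_extend_last T))

theorem sum_colStab_extend {M : Type*} [AddCommMonoid M] (F : Equiv.Perm (Fin (n + 1)) → M) :
    ∑ q : (h.extend T).colStab, F q = ∑ q : T.colStab, F (stdHom n q) := by
  symm
  refine Fintype.sum_bijective
    (fun q : T.colStab => (⟨stdHom n q, (h.stdHom_mem_colStab T).2 q.2⟩ : (h.extend T).colStab))
    ⟨fun p q hpq => ?_, fun q => ?_⟩ _ _ fun q => rfl
  · exact Subtype.ext (stdHom_injective n (congrArg Subtype.val hpq))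
  · obtain ⟨p, hp⟩ := exists_stdHom_eq (h.apply_last_of_mem_colStab T q.2)
    refine ⟨⟨p, (h.stdHom_mem_colStab T).1 (hp ▸ q.2)⟩, Subtype.ext hp⟩

/-! ### Symmetrizers of the extended tableau -/

section Symmetrizers

variable {X X' : Type*} [AddCommGroup X] [Module ℚ X] [AddCommGroup X'] [Module ℚ X']
  (ρ : Representation ℚ (Equiv.Perm (Fin n)) X)
  (ρ' : Representation ℚ (Equiv.Perm (Fin (n + 1))) X')
  (ι : X →ₗ[ℚ] X')

theorem colSym_extend (hι : ∀ σ x, ι (ρ σ x) = ρ' (stdHom n σ) (ι x)) (x : X) :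
    colSym (h.extend T) ρ' (ι x) = ι (colSym T ρ x) := by
  rw [colSym_apply, colSym_apply, map_sum, h.sum_colStab_extend T fun q =>
    ((Equiv.Perm.sign q : ℤ) : ℚ) • ρ' q (ι x)]
  refine Finset.sum_congr rfl fun q _ => ?_
  rw [sign_stdHom, map_smul, hι]

theorem rowSym_extend (hι : ∀ σ x, ι (ρ σ x) = ρ' (stdHom n σ) (ι x)) (x : X) :
    rowSym (h.extend T) ρ' (ι x) =
    ∑ i with (h.extend T).rowOf i = c₀.1,
      ρ' (Equiv.swap i (Fin.last n)) (ι (rowSym T ρ x)) := by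
  classical
  have hswap : ∀ i, (h.extend T).rowOf i = c₀.1 →
      ∀ y, (h.extend T).rowOf (Equiv.swap i (Fin.last n) y) = (h.extend T).rowOf y := by
    intro i hi y
    rw [Equiv.swap_apply_def]
    split_ifs with h1 h2
    · rw [rowOf_extend_last, h1, hi]
    · rw [h2, rowOf_extend_last, hi]
    · rfl
  rw [rowSym_apply, rowSym_apply]
  simp only [map_sum]
  rw [← Finset.sum_product']
  symm
  -- A row permutation σ factors uniquely as (i n+1)π with i = σ(n+1), a letter in the row of the
  -- new box, and π a row permutation of T.
  refine Finset.sum_nbij (fun p => Equiv.swap p.1 (Fin.last n) * stdHom n p.2) ?_ ?_ ?_ ?_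
  · rintro ⟨i, π⟩ hp
    simp only [Finset.mem_product, Finset.mem_filter_univ, Tabloid.smul_mk_eq_self] at hp ⊢
    intro y
    rw [Equiv.Perm.mul_apply, hswap i hp.1]
    induction y using Fin.lastCases with
    | last => rw [stdHom_last]
    | cast y => rw [stdHom_castSucc, rowOf_extend_castSucc, rowOf_extend_castSucc, hp.2]
  · rintro ⟨i, π⟩ - ⟨j, π'⟩ - hij
    have h1 := congrArg (fun f : Equiv.Perm (Fin (n + 1)) => f (Fin.last n)) hij
    simp only [Equiv.Perm.mul_apply, stdHom_last, Equiv.swap_apply_right] at h1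
    subst h1
    exact Prod.ext rfl (stdHom_injective n (mul_left_cancel hij))
  · intro σ hσ
    simp only [Finset.coe_filter, Finset.mem_univ, true_and, Set.mem_ofPred_eq,
      Tabloid.smul_mk_eq_self] at hσ
    have hi : (h.extend T).rowOf (σ (Fin.last n)) = c₀.1 := by
      rw [hσ, rowOf_extend_last]
    obtain ⟨π, hπ⟩ := exists_stdHom_eq
      (σ := Equiv.swap (σ (Fin.last n)) (Fin.last n) * σ) (by simp)
    refine ⟨(σ (Fin.last n), π), ?_, ?_⟩
    · simp only [Finset.coe_product, Finset.coe_filter, Finset.mem_univ, true_and, Set.mem_prod,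
        Set.mem_ofPred_eq, Tabloid.smul_mk_eq_self]
      refine ⟨hi, fun y => ?_⟩
      rw [← h.rowOf_extend_castSucc, ← stdHom_castSucc, hπ, Equiv.Perm.mul_apply, hswap _ hi, hσ,
        h.rowOf_extend_castSucc]
    · simp only [hπ, ← mul_assoc, Equiv.swap_mul_self, one_mul]
  · rintro ⟨i, π⟩ -
    rw [map_mul, Module.End.mul_apply, hι]

end Symmetrizers

/-! ### Extension maps on tabloids and Specht modules -/

/-- The map of tabloids that puts the new label into the row of the new box. -/
noncomputable def tabloidExtend : Tabloid μ n → Tabloid μ' (n + 1) :=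
  Quotient.map h.extend fun T S hTS x => by
    induction x using Fin.lastCases with
    | last => rw [rowOf_extend_last, rowOf_extend_last]
    | cast x => rw [rowOf_extend_castSucc, rowOf_extend_castSucc]; exact hTS x

theorem tabloidExtend_smul (σ : Equiv.Perm (Fin n)) (t : Tabloid μ n) :
    h.tabloidExtend (σ • t) = stdHom n σ • h.tabloidExtend t := by
  induction t using Quotient.inductionOn with | h T => ?_
  exact congrArg Tabloid.mk (h.extend_smul T σ)

/-- The linear map `M^μ → M^μ'` that extends tabloids. -/
noncomputable def tabloidMap : ℚ[Tabloid μ n] →ₗ[ℚ] ℚ[Tabloid μ' (n + 1)] :=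
  linExt fun t => MonoidAlgebra.single (h.tabloidExtend t) 1

theorem tabloidMap_equivariant (σ : Equiv.Perm (Fin n)) (v : ℚ[Tabloid μ n]) :
    h.tabloidMap (tabloidRep μ n σ v) = tabloidRep μ' (n + 1) (stdHom n σ) (h.tabloidMap v) := by
  suffices h.tabloidMap ∘ₗ tabloidRep μ n σ =
      tabloidRep μ' (n + 1) (stdHom n σ) ∘ₗ h.tabloidMap from LinearMap.congr_fun this v
  refine linear_ext_single fun t => ?_
  simp only [LinearMap.comp_apply, Representation.ofMulAction_single, tabloidMap, linExt_single,
    one_smul, tabloidExtend_smul]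

theorem tabloidMap_polytabloid : h.tabloidMap (polytabloid T) = polytabloid (h.extend T) := by
  rw [polytabloid_eq_colSym, polytabloid_eq_colSym,
    ← h.colSym_extend T _ _ h.tabloidMap h.tabloidMap_equivariant, tabloidMap, linExt_single,
    one_smul]
  rfl

/-- The linear map of Specht modules that extends polytabloids. -/
noncomputable def spechtMap : (specht μ n).toSubmodule →ₗ[ℚ] (specht μ' (n + 1)).toSubmodule :=
  h.tabloidMap.restrict fun v hv => by
    have : (specht μ n).toSubmodule ≤ (specht μ' (n + 1)).toSubmodule.comap h.tabloidMap := by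
      refine Submodule.span_le.2 ?_
      rintro _ ⟨T, rfl⟩
      exact Submodule.subset_span ⟨h.extend T, (h.tabloidMap_polytabloid T).symm⟩
    exact this hv

theorem spechtMap_spechtVec : h.spechtMap (spechtVec T) = spechtVec (h.extend T) :=
  Subtype.ext (h.tabloidMap_polytabloid T)

theorem spechtMap_equivariant (σ : Equiv.Perm (Fin n)) (v : (specht μ n).toSubmodule) :
    h.spechtMap ((specht μ n).toRepresentation σ v) =
      (specht μ' (n + 1)).toRepresentation (stdHom n σ) (h.spechtMap v) :=
  Subtype.ext (h.tabloidMap_equivariant σ v.1)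

end AddsColumn

/-! ### Relations between polytabloids -/

section Relations

variable {μ : YoungDiagram} {n : ℕ} (T : Tableau μ n)

theorem spechtVec_swap_of_colOf_eq {x y : Fin n} (hxy : x ≠ y) (h : T.colOf x = T.colOf y) :
    spechtVec (Equiv.swap x y • T) = -spechtVec T := by
  have hq : Equiv.swap x y ∈ T.colStab := fun z => by
    rw [Equiv.swap_apply_def]; split_ifs with h1 h2
    · rw [h1, h]
    · rw [h2, h]
    · rfl
  apply Subtype.ext
  change polytabloid _ = -polytabloid T
  rw [← tabloidRep_polytabloid, polytabloid_eq_colSym, map_colSym_of_mem T _ hq,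
    Equiv.Perm.sign_swap hxy]
  simp

/-- Column permutations fix x and y, so in every tabloid of the sum these labels keep their common
row, and exchanging them changes nothing. -/
theorem spechtVec_swap_of_alone {x y : Fin n} (hx : ∀ z, T.colOf z = T.colOf x → z = x)
    (hy : ∀ z, T.colOf z = T.colOf y → z = y) (h : T.rowOf x = T.rowOf y) :
    spechtVec (Equiv.swap x y • T) = spechtVec T := by
  apply Subtype.ext
  change polytabloid _ = polytabloid T
  rw [← tabloidRep_polytabloid, polytabloid, map_sum]
  refine Finset.sum_congr rfl fun q _ => ?_
  rw [Representation.ofMulAction_single]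
  congr 1
  have h1 : ∀ z, (∀ w, T.colOf w = T.colOf z → w = z) →
      ((q : Equiv.Perm (Fin n)) • T).rowOf z = T.rowOf z := fun z hz => by
    rw [Tableau.rowOf_smul, hz _ (T.colStab.inv_mem q.2 z)]
  rw [Tabloid.smul_mk_eq_self]
  intro z
  rw [Equiv.swap_apply_def]
  split_ifs with h2 h3
  · rw [h2, h1 x hx, h1 y hy, h]
  · rw [h3, h1 x hx, h1 y hy, h]
  · rfl

end Relations

/-! ### Padded partitions -/

section Padded

variable {lam : YoungDiagram} {n : ℕ} (h : IsPaddable lam n)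

theorem zero_mem_padded {j : ℕ} : (0, j) ∈ padded lam n h ↔ j < n - lam.card := by
  rw [padded, YoungDiagram.mem_ofRowLens]
  simp

theorem succ_mem_padded {i j : ℕ} : (i + 1, j) ∈ padded lam n h ↔ (i, j) ∈ lam := by
  conv_rhs => rw [← YoungDiagram.ofRowLens_to_rowLens_eq_self (μ := lam)]
  rw [padded, YoungDiagram.mem_ofRowLens, YoungDiagram.mem_ofRowLens]
  simp

theorem lt_rowLen_zero_of_mem {i j : ℕ} (hc : (i + 1, j) ∈ padded lam n h) :
    j < lam.rowLen 0 := by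
  rw [succ_mem_padded, YoungDiagram.mem_iff_lt_rowLen] at hc
  exact hc.trans_le (lam.rowLen_anti 0 i (Nat.zero_le i))

theorem lt_of_mem_padded {c : ℕ × ℕ} (hc : c ∈ padded lam n h) : c.2 < n - lam.card := by
  obtain ⟨i, j⟩ := c
  cases i with
  | zero => exact (zero_mem_padded h).1 hc
  | succ i =>
    have h1 := lt_rowLen_zero_of_mem h hc
    have h2 : lam.card + lam.rowLen 0 ≤ n := h
    change j < _
    omega

theorem addsColumn_padded :
    AddsColumn (padded lam n h) (padded lam (n + 1) h.succ) (0, n - lam.card) where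
  cells_eq := by
    ext ⟨i, j⟩
    have h2 : lam.card + lam.rowLen 0 ≤ n := h
    rw [Finset.mem_insert, YoungDiagram.mem_cells, YoungDiagram.mem_cells]
    cases i with
    | zero =>
      rw [zero_mem_padded, zero_mem_padded, Prod.mk.injEq]
      omega
    | succ i =>
      rw [succ_mem_padded, succ_mem_padded]
      simp
  col_ne c hc := (lt_of_mem_padded h hc).ne

theorem card_padded : (padded lam n h).card = n := by
  have h1 : (padded lam n h).cells =
      (Finset.range (n - lam.card)).image (fun j => ((0 : ℕ), j)) ∪
      lam.cells.image fun c => (c.1 + 1, c.2) := by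
    ext ⟨i, j⟩
    rw [Finset.mem_union, Finset.mem_image, Finset.mem_image, YoungDiagram.mem_cells]
    cases i with
    | zero => rw [zero_mem_padded]; simp
    | succ i => rw [succ_mem_padded]; simp
  have h2 : lam.card + lam.rowLen 0 ≤ n := h
  rw [YoungDiagram.card, h1, Finset.card_union_of_disjoint, Finset.card_image_of_injective,
    Finset.card_image_of_injective, Finset.card_range]
  · change n - lam.card + lam.card = n
    omega
  · intro c d hcd
    simpa [Prod.ext_iff] using hcd
  · intro c d hcd
    simpa using hcd
  · rw [Finset.disjoint_left]
    rintro ⟨i, j⟩ hij hij'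
    simp only [Finset.mem_image, Prod.mk.injEq] at hij hij'
    obtain ⟨_, _, h3, _⟩ := hij
    obtain ⟨_, _, h4, _⟩ := hij'
    omega

theorem nonempty_tableau_padded : Nonempty (Tableau (padded lam n h) n) :=
  ⟨Fintype.equivOfCardEq (by rw [Fintype.card_coe, Fintype.card_fin]; exact card_padded h)⟩

theorem rowLen_zero_le_card (lam : YoungDiagram) : lam.rowLen 0 ≤ lam.card := by
  rw [YoungDiagram.rowLen_eq_card]
  exact Finset.card_le_card (Finset.filter_subset _ _)

end Padded

/-! ### Functionals on Specht modules invariant under the permutations of the last letters -/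

section Invariant

variable {k : ℕ} {V : Type*} [AddCommGroup V] [Module ℚ V]

theorem swap_apply_of_lt {k n : ℕ} {x y : Fin n} (hx : k ≤ (x : ℕ)) (hy : k ≤ (y : ℕ))
    (i : Fin n) (hi : (i : ℕ) < k) : Equiv.swap x y i = i := by
  refine Equiv.swap_apply_of_ne_of_ne ?_ ?_
  · rintro rfl; omega
  · rintro rfl; omega

/-- The functional `ψ` is invariant under the permutations that fix the first `k` letters. -/
def IsLastInvariant (k : ℕ) {μ : YoungDiagram} {n : ℕ}
    (ψ : (specht μ n).toSubmodule →ₗ[ℚ] V) : Prop :=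
  ∀ σ : Equiv.Perm (Fin n), (∀ i : Fin n, (i : ℕ) < k → σ i = i) →
    ∀ x, ψ ((specht μ n).toRepresentation σ x) = ψ x

variable {μ : YoungDiagram} {n : ℕ} {ψ : (specht μ n).toSubmodule →ₗ[ℚ] V}

/-- The transposition of x and y fixes the value by invariance and negates it by the column
antisymmetry. -/
theorem apply_spechtVec_eq_zero_of_colOf_eq (hψ : IsLastInvariant k ψ)
    {T : Tableau μ n} {x y : Fin n} (hxy : x ≠ y)
    (hx : k ≤ (x : ℕ)) (hy : k ≤ (y : ℕ)) (h : T.colOf x = T.colOf y) :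
    ψ (spechtVec T) = 0 := by
  have h1 := hψ (Equiv.swap x y) (swap_apply_of_lt hx hy) (spechtVec T)
  rw [specht_spechtVec, spechtVec_swap_of_colOf_eq T hxy h, map_neg] at h1
  exact eq_zero_of_eq_neg h1.symm

/-- If all letters after the first `k` lie in the first `b` columns, and there are more than `b` of
them, then the functional vanishes. -/
theorem apply_spechtVec_eq_zero_of_lt (hψ : IsLastInvariant k ψ) {T : Tableau μ n} {b : ℕ}
    (hb : k + b < n)
    (h : ∀ x : Fin n, k ≤ (x : ℕ) → T.colOf x < b) : ψ (spechtVec T) = 0 := by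
  obtain ⟨x, -, y, -, hxy, hc⟩ := Finset.exists_ne_map_eq_of_card_lt_of_maps_to
    (s := (Finset.univ : Finset (Fin (n - k)))) (t := Finset.range b)
    (f := fun x => T.colOf ⟨k + x, by omega⟩) (by simp; omega)
    (fun x _ => by simpa using h _ (by simp))
  refine apply_spechtVec_eq_zero_of_colOf_eq hψ (fun h => hxy ?_) ?_ ?_ hc
  · simpa [Fin.ext_iff] using h
  · simp
  · simp

/-- The diagram has n - |λ| columns, fewer than the n - k letters that must avoid sharing one. -/
theorem eq_zero_of_lt_card {lam : YoungDiagram} (h : IsPaddable lam n)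
    {ψ : (specht (padded lam n h) n).toSubmodule →ₗ[ℚ] V} (hψ : IsLastInvariant k ψ)
    (hk : k < lam.card) : ψ = 0 := by
  have h1 : lam.card + lam.rowLen 0 ≤ n := h
  exact specht_hom_ext fun T => apply_spechtVec_eq_zero_of_lt hψ (b := n - lam.card) (by omega)
    fun x _ => lt_of_mem_padded h (T.symm x).2

end Invariant

/-- A polytabloid of shape λ[n+1] either has two of the last n+1-k letters in one column, or has
such a letter x beyond column λ_1. In the second case, invariance replaces x by the last letter, and
exchanging it with the entry of the new box leaves the polytabloid unchanged, so the value is one on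
an extended polytabloid. -/
theorem eq_zero_of_comp_spechtMap_eq_zero {k n : ℕ} {V : Type*} [AddCommGroup V] [Module ℚ V]
    {lam : YoungDiagram} (h : IsPaddable lam n) (hn : k + lam.rowLen 0 ≤ n)
    {ψ : (specht (padded lam (n + 1) h.succ) (n + 1)).toSubmodule →ₗ[ℚ] V}
    (hψ : IsLastInvariant k ψ)
    (h0 : ψ ∘ₗ (addsColumn_padded h).spechtMap = 0) : ψ = 0 := by
  refine specht_hom_ext fun S => ?_
  rw [LinearMap.zero_apply]
  by_cases hS : ∀ x : Fin (n + 1), k ≤ (x : ℕ) → S.colOf x < lam.rowLen 0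
  · exact apply_spechtVec_eq_zero_of_lt hψ (by omega) hS
  push Not at hS
  obtain ⟨x, hkx, hx⟩ := hS
  -- From column index λ_1 on, each column consists of a single box of the top row.
  have hrow : ∀ {μ : YoungDiagram} (c : μ.cells), μ = padded lam (n + 1) h.succ →
      lam.rowLen 0 ≤ c.1.2 → c.1.1 = 0 := by
    rintro μ ⟨⟨i, j⟩, hc⟩ rfl hj
    cases i with
    | zero => rfl
    | succ i => exact absurd (lt_rowLen_zero_of_mem h.succ hc) (not_lt.2 hj)
  have halone : ∀ (R : Tableau (padded lam (n + 1) h.succ) (n + 1)) (y : Fin (n + 1)),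
      lam.rowLen 0 ≤ R.colOf y → ∀ z, R.colOf z = R.colOf y → z = y := by
    intro R y hy z hz
    apply R.symm.injective
    refine Subtype.ext (Prod.ext ?_ hz)
    rw [hrow (R.symm y) rfl hy, hrow (R.symm z) rfl]
    exact hy.trans_eq hz.symm
  let R := Equiv.swap x (Fin.last n) • S
  have hR : ψ (spechtVec S) = ψ (spechtVec R) := by
    rw [← specht_spechtVec, hψ _ (swap_apply_of_lt hkx (by simp; omega))]
  have hRlast : R.colOf (Fin.last n) = S.colOf x := by
    simp [R, Tableau.colOf_smul]
  have hc₀ : (0, n - lam.card) ∈ (padded lam (n + 1) h.succ).cells := by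
    rw [(addsColumn_padded h).cells_eq]
    exact Finset.mem_insert_self _ _
  let y := R ⟨_, hc₀⟩
  have hy : R.symm y = ⟨_, hc₀⟩ := R.symm_apply_apply _
  have hycol : lam.rowLen 0 ≤ R.colOf y := by
    have h1 : R.colOf y = n - lam.card := congrArg (fun c => c.1.2) hy
    have h2 : lam.card + lam.rowLen 0 ≤ n := h
    omega
  have hRcol : lam.rowLen 0 ≤ R.colOf (Fin.last n) := hx.trans_eq hRlast.symm
  have hswap := spechtVec_swap_of_alone R (halone R y hycol) (halone R (Fin.last n) hRcol)
    ((hrow (R.symm y) rfl hycol).trans (hrow (R.symm (Fin.last n)) rfl hRcol).symm)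
  obtain ⟨T, hT⟩ := (addsColumn_padded h).exists_extend_eq (nonempty_tableau_padded h)
    (S := Equiv.swap y (Fin.last n) • R) (by
      change (R.symm ((Equiv.swap y (Fin.last n))⁻¹ (Fin.last n))).1 = _
      rw [Equiv.swap_inv, Equiv.swap_apply_right, hy])
  rw [hR, ← hswap, ← hT, ← AddsColumn.spechtMap_spechtVec]
  exact LinearMap.congr_fun h0 _

/-! ### The sequence of induced representations -/

section Main

variable {k : ℕ} {V : Type*} [AddCommGroup V] [Module ℚ V]
  (ρ : Representation ℚ (Equiv.Perm (Fin k)) V)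

theorem indProj_apply_of_fix {ℓ : ℕ} {σ : Equiv.Perm (Fin (k + ℓ))}
    (hσ : ∀ i : Fin (k + ℓ), (i : ℕ) < k → σ i = i) (x : IndSpace ρ ℓ) :
    indProj ρ ℓ (indRep ρ ℓ σ x) = indProj ρ ℓ x := by
  obtain ⟨g, rfl⟩ := exists_youngHom_one hσ
  rw [indProj_youngHom, map_one, Module.End.one_apply]

theorem eq_zero_of_indProj_comp_eq_zero {ℓ : ℕ} {X : Type*} [AddCommGroup X] [Module ℚ X]
    {τ : Representation ℚ (Equiv.Perm (Fin (k + ℓ))) X} {f : X →ₗ[ℚ] IndSpace ρ ℓ}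
    (hf : ∀ σ x, f (τ σ x) = indRep ρ ℓ σ (f x)) (h : indProj ρ ℓ ∘ₗ f = 0) : f = 0 := by
  refine LinearMap.ext fun x => ind_eq_zero ρ ℓ fun σ => ?_
  rw [← hf]
  exact LinearMap.congr_fun h _

theorem linearIndependent_of_apply {ι X Y : Type*} [AddCommGroup X] [Module ℚ X]
    [AddCommGroup Y] [Module ℚ Y] {f : ι → X →ₗ[ℚ] Y} (x : X)
    (h : LinearIndependent ℚ fun i => f i x) : LinearIndependent ℚ f :=
  LinearIndependent.of_comp (LinearMap.applyₗ x) h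

/-- Each embedding is restricted along V(λ)_n → V(λ)_{n+1} and projected to V, then induced back to
a map into I_n(V). Independence survives because an invariant functional is determined by that
restriction. -/
theorem exists_isCopies_of_succ {lam : YoungDiagram} {ℓ m : ℕ} (h : IsPaddable lam (k + ℓ))
    (hℓ : lam.rowLen 0 ≤ ℓ) {W : Subrepresentation (indRep ρ (ℓ + 1))}
    (hW : IsCopies W (stableIrrep lam (k + (ℓ + 1)) h.succ) m) :
    ∃ U : Subrepresentation (indRep ρ ℓ), IsCopies U (stableIrrep lam (k + ℓ) h) m := by
  obtain ⟨f, hf, -, hli⟩ := IsCopies.exists_homs (indRep ρ (ℓ + 1)) hW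
  obtain ⟨T⟩ := nonempty_tableau_padded (n := k + (ℓ + 1)) h.succ
  replace hli := linearIndependent_of_apply _ (hli _ (spechtVec_ne_zero T))
  let j := (addsColumn_padded h).spechtMap (n := k + ℓ)
  let ψ : Fin m → (specht (padded lam (k + ℓ) h) (k + ℓ)).toSubmodule →ₗ[ℚ] V := fun i =>
    indProj ρ (ℓ + 1) ∘ₗ f i ∘ₗ j
  have hψ : ∀ i g x, ψ i ((specht (padded lam (k + ℓ) h) (k + ℓ)).toRepresentation
      (youngHom k ℓ g) x) = ρ g.1 (ψ i x) := fun i g x => by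
    -- The embedding into S_{k+ℓ+1} extends the S_ℓ-factor to S_{ℓ+1}, which acts trivially on V,
    -- and leaves the S_k-factor alone.
    have h1 : j ((specht (padded lam (k + ℓ) h) (k + ℓ)).toRepresentation (youngHom k ℓ g) x) =
        (specht (padded lam (k + (ℓ + 1)) h.succ) (k + (ℓ + 1))).toRepresentation
          (youngHom k (ℓ + 1) (g.1, stdHom ℓ g.2)) (j x) := by
      rw [youngHom_stdHom]
      exact (addsColumn_padded h).spechtMap_equivariant _ x
    simp only [ψ, LinearMap.comp_apply]
    rw [h1, hf, indProj_youngHom]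
  have hψli : ∀ c : Fin m → ℚ, ∑ i, c i • ψ i = 0 → ∀ i, c i = 0 := by
    intro c hc
    refine Fintype.linearIndependent_iff.1 hli c ?_
    have hF : ∀ σ x, (∑ i, c i • f i) ((specht (padded lam (k + (ℓ + 1)) h.succ)
        (k + (ℓ + 1))).toRepresentation σ x) = indRep ρ (ℓ + 1) σ ((∑ i, c i • f i) x) := by
      intro σ x
      simp only [LinearMap.sum_apply, LinearMap.smul_apply, hf, map_sum, map_smul]
    refine eq_zero_of_indProj_comp_eq_zero ρ hF ?_
    refine eq_zero_of_comp_spechtMap_eq_zero (k := k) h (by omega) (fun σ hσ x => ?_) ?_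
    · rw [LinearMap.comp_apply, LinearMap.comp_apply]
      refine (congrArg _ (hF σ x)).trans ?_
      exact indProj_apply_of_fix ρ (ℓ := ℓ + 1) hσ _
    · rw [← hc]
      refine LinearMap.ext fun x => ?_
      simp only [ψ, LinearMap.comp_apply, LinearMap.sum_apply, LinearMap.smul_apply, map_sum,
        map_smul, j]
  let τ := (specht (padded lam (k + ℓ) h) (k + ℓ)).toRepresentation
  obtain ⟨U, -, hU⟩ := exists_isCopies (indRep ρ ℓ) (fun i => indLift ρ ℓ τ (ψ i))
    (fun i σ x => indLift_equivariant ρ ℓ τ (ψ i) σ x) (by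
      rw [Fintype.linearIndependent_iff]
      intro c hc
      refine hψli c (LinearMap.ext fun x => ?_)
      have h1 := congrArg (fun F => indProj ρ ℓ (F x)) hc
      simp only [LinearMap.sum_apply, LinearMap.smul_apply, map_sum, map_smul,
        LinearMap.zero_apply, map_zero] at h1 ⊢
      rw [Finset.sum_congr rfl fun i _ => by rw [indProj_indLift ρ ℓ τ (ψ i) (hψ i), smul_comm],
        ← Finset.smul_sum] at h1
      exact (smul_eq_zero.1 h1).resolve_left (Nat.cast_ne_zero.2 Fintype.card_ne_zero)) ⊤
    (fun i T => trivial)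
  exact ⟨U, hU⟩

theorem IsCopies.eq_zero_of_lt_card {lam : YoungDiagram} {ℓ m : ℕ} {h : IsPaddable lam (k + ℓ)}
    (hk : k < lam.card)
    {W : Subrepresentation (indRep ρ ℓ)} (hW : IsCopies W (stableIrrep lam (k + ℓ) h) m) :
    m = 0 := by
  obtain ⟨f, hf, -, hli⟩ := IsCopies.exists_homs (indRep ρ ℓ) hW
  obtain ⟨T⟩ := nonempty_tableau_padded h
  by_contra hm
  have h0 : f ⟨0, Nat.pos_of_ne_zero hm⟩ = 0 := by
    refine eq_zero_of_indProj_comp_eq_zero ρ (hf _) ?_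
    refine RepStability.eq_zero_of_lt_card (k := k) h (fun σ hσ x => ?_) hk
    rw [LinearMap.comp_apply, hf, indProj_apply_of_fix ρ hσ]
    rfl
  refine (hli _ (spechtVec_ne_zero T)).ne_zero ⟨0, Nat.pos_of_ne_zero hm⟩ ?_
  rw [h0, LinearMap.zero_apply]

/-! ### Monotonicity -/

variable [FiniteDimensional ℚ V]

theorem inducedSequence_isMonotone : (inducedSequence ρ).IsMonotone k := by
  intro ℓ _ lam h m W hW
  obtain ⟨f, hf, hfW, hli⟩ := IsCopies.exists_homs (indRep ρ ℓ) hW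
  obtain ⟨T⟩ := nonempty_tableau_padded h
  let A := addsColumn_padded h
  have hι : ∀ σ x, indInclusion ρ ℓ (indRep ρ ℓ σ x) =
      indRep ρ (ℓ + 1) (stdHom (k + ℓ) σ) (indInclusion ρ ℓ x) := indInclusion_equivariant ρ ℓ
  let ρ' : Representation ℚ (Equiv.Perm (Fin (k + ℓ + 1))) (IndSpace ρ (ℓ + 1)) :=
    indRep ρ (ℓ + 1)
  let s : Finset (Fin (k + ℓ + 1)) := {i | (A.extend T).rowOf i = 0}
  let z : Fin m → IndSpace ρ (ℓ + 1) := fun i => indInclusion ρ ℓ (f i (spechtVec T))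
  -- The polytabloid is itself a column symmetrization, and the column symmetrizer squares to the
  -- order of the column group times itself.
  have hb : ∀ i, colSym T (indRep ρ ℓ) (f i (spechtVec T)) =
      (Fintype.card T.colStab : ℚ) • f i (spechtVec T) := fun i => by
    have h1 : colSym T (specht (padded lam (k + ℓ) h) (k + ℓ)).toRepresentation (spechtVec T) =
        (Fintype.card T.colStab : ℚ) • spechtVec T := by
      apply Subtype.ext
      refine (map_colSym T (specht (padded lam (k + ℓ) h) (k + ℓ)).toRepresentation
        (tabloidRep _ _) (Submodule.subtype _) (fun σ x => rfl) (spechtVec T)).trans ?_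
      change colSym T _ (polytabloid T) = _ • polytabloid T
      rw [polytabloid_eq_colSym, colSym_colSym]
    rw [← map_colSym T _ _ (f i) (hf i), h1, map_smul]
  have hab : ∀ i, rowSym (A.extend T) ρ' (colSym (A.extend T) ρ' (z i)) =
      (Fintype.card T.colStab : ℚ) • swapSum ρ ℓ s
        (f i (rowSym T (specht (padded lam (k + ℓ) h) (k + ℓ)).toRepresentation
          (spechtVec T))) := fun i => by
    rw [A.colSym_extend T (indRep ρ ℓ) ρ' _ hι, hb, map_smul, map_smul,
      A.rowSym_extend T (indRep ρ ℓ) ρ' _ hι, map_rowSym T _ _ (f i) (hf i)]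
    simp only [swapSum, LinearMap.sum_apply, LinearMap.comp_apply]
    rfl
  have hcard : (Fintype.card T.colStab : ℚ) ≠ 0 := Nat.cast_ne_zero.2 Fintype.card_ne_zero
  have hliab : ∀ c : Fin m → ℚ,
      rowSym (A.extend T) ρ' (colSym (A.extend T) ρ' (∑ i, c i • z i)) = 0 → ∀ i, c i = 0 := by
    intro c hc
    have h1 : swapSum ρ ℓ s (∑ i, c i •
        f i (rowSym T (specht (padded lam (k + ℓ) h) (k + ℓ)).toRepresentation (spechtVec T))) =
        0 := by
      simp only [map_sum, map_smul, hab] at hc ⊢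
      rw [← smul_eq_zero_iff_right hcard, Finset.smul_sum, ← hc]
      exact Finset.sum_congr rfl fun i _ => smul_comm _ _ _
    have hs : Fin.last (k + ℓ) ∈ s := by
      simp only [s, Finset.mem_filter_univ]
      exact A.rowOf_extend_last T
    have h2 := (map_eq_zero_iff _ (swapSum_injective ρ ℓ s hs)).1 h1
    exact Fintype.linearIndependent_iff.1 (hli _ (rowSym_spechtVec_ne_zero T)) c h2
  let w : Fin m → IndSpace ρ (ℓ + 1) := fun i => colSym (A.extend T) ρ' (z i)
  -- Sending {T'} to the row symmetrization of w_i is well defined on tabloids. On the polytabloid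
  -- of T' it yields the column, row, column symmetrization of z_i.
  let g : Fin m → (specht (padded lam (k + ℓ + 1) h.succ) (k + ℓ + 1)).toSubmodule →ₗ[ℚ]
      IndSpace ρ (ℓ + 1) := fun i =>
    tabloidLift (A.extend T) ρ' (w i) ∘ₗ Submodule.subtype _
  have hg : ∀ i σ x, g i ((specht (padded lam (k + ℓ + 1) h.succ)
      (k + ℓ + 1)).toRepresentation σ x) = ρ' σ (g i x) := fun i σ x =>
    tabloidLift_equivariant (A.extend T) ρ' (w i) σ x.1
  have hgT : ∀ i, g i (spechtVec (A.extend T)) =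
      colSym (A.extend T) ρ' (rowSym (A.extend T) ρ' (w i)) := fun i =>
    tabloidLift_polytabloid (A.extend T) ρ' (w i)
  have hgli : LinearIndependent ℚ g := by
    refine linearIndependent_of_apply (spechtVec (A.extend T)) ?_
    rw [Fintype.linearIndependent_iff]
    intro c hc
    refine hliab c (rowSym_colSym_eq_zero _ _ ?_)
    rw [← hc]
    simp only [hgT, w, map_sum, map_smul]
  let Y := (inducedSequence ρ).spanImage ℓ W.toSubmodule
  have hz : ∀ i, z i ∈ Y.toSubmodule := fun i =>
    Submodule.subset_span ⟨1, z i, ⟨_, hfW i _, rfl⟩,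
      (LinearMap.congr_fun (map_one ρ') (z i)).symm⟩
  refine exists_isCopies ρ' g hg hgli Y fun i S => ?_
  obtain ⟨σ, rfl⟩ := (A.extend T).exists_smul_eq S
  rw [← specht_spechtVec, hg, hgT]
  refine Y.apply_mem_toSubmodule σ (colSym_mem _ _ Y ?_)
  rw [rowSym_apply]
  exact Submodule.sum_mem _ fun π _ => Y.apply_mem_toSubmodule π (colSym_mem _ _ Y (hz i))

/-! ### Multiplicities -/

theorem IsCopies.le_finrank {lam : YoungDiagram} {ℓ m : ℕ} {h : IsPaddable lam (k + ℓ)}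
    {W : Subrepresentation (indRep ρ ℓ)} (hW : IsCopies W (stableIrrep lam (k + ℓ) h) m) :
    m ≤ Module.finrank ℚ (IndSpace ρ ℓ) := by
  obtain ⟨f, hf, -, hli⟩ := IsCopies.exists_homs (indRep ρ ℓ) hW
  obtain ⟨T⟩ := nonempty_tableau_padded h
  simpa using (hli _ (spechtVec_ne_zero T)).fintype_card_le_finrank

theorem mult_eq_zero_of_lt_card {lam : YoungDiagram} (hk : k < lam.card) (ℓ : ℕ) :
    (inducedSequence ρ).mult lam ℓ = 0 := by
  unfold ConsistentSequence.mult
  split_ifs with h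
  · rw [multiplicity, ← bot_eq_zero, sSup_eq_bot]
    rintro _ ⟨m, rfl, W, hW⟩
    rw [IsCopies.eq_zero_of_lt_card ρ hk hW]
    rfl
  · rfl

/-- The two sets of admissible m coincide: monotonicity carries copies up, and
`exists_isCopies_of_succ` carries them down. -/
theorem mult_succ {lam : YoungDiagram} {ℓ : ℕ} (h : IsPaddable lam (k + ℓ))
    (hℓ : lam.rowLen 0 ≤ ℓ) :
    (inducedSequence ρ).mult lam (ℓ + 1) = (inducedSequence ρ).mult lam ℓ := by
  have h' : IsPaddable lam (k + (ℓ + 1)) := h.succ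
  rw [ConsistentSequence.mult, ConsistentSequence.mult, dif_pos h, dif_pos h', multiplicity,
    multiplicity]
  congr 1
  ext c
  constructor
  · rintro ⟨m, rfl, W, hW⟩
    exact ⟨m, rfl, exists_isCopies_of_succ ρ h hℓ hW⟩
  · rintro ⟨m, rfl, W, hW⟩
    obtain ⟨U, -, hU⟩ := inducedSequence_isMonotone ρ ℓ (Nat.le_add_right k ℓ) lam h m W hW
    exact ⟨m, rfl, U, hU⟩

theorem mult_ne_top (lam : YoungDiagram) (ℓ : ℕ) : (inducedSequence ρ).mult lam ℓ ≠ ⊤ := by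
  unfold ConsistentSequence.mult
  split_ifs with h
  · refine ne_top_of_le_ne_top (ENat.natCast_ne_top (Module.finrank ℚ (IndSpace ρ ℓ))) (sSup_le ?_)
    rintro _ ⟨m, rfl, W, hW⟩
    exact Nat.cast_le.2 (IsCopies.le_finrank ρ hW)
  · exact ENat.zero_ne_top

theorem inducedSequence_isUniformlyRepresentationStable :
    (inducedSequence ρ).IsUniformlyRepresentationStable (2 * k) where
  injectivity ℓ _ := indInclusion_injective ρ ℓ
  surjectivity ℓ _ := groupSpan_image_indInclusion ρ ℓ
  multiplicity_stable lam := by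
    rcases lt_or_ge k lam.card with hk | hk
    · exact ⟨0, fun ℓ _ => mult_eq_zero_of_lt_card ρ hk ℓ⟩
    · obtain ⟨c, hc⟩ := ENat.ne_top_iff_exists.1 (mult_ne_top ρ lam k)
      refine ⟨c, fun ℓ hℓ => ?_⟩
      have hkℓ : k ≤ ℓ := by omega
      have hr := rowLen_zero_le_card lam
      rw [hc]
      induction ℓ, hkℓ using Nat.le_induction with
      | base => rfl
      | succ ℓ hkℓ ih =>
        rw [mult_succ ρ (show lam.card + lam.rowLen 0 ≤ k + ℓ by omega) (by omega),
          ih (by omega)]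

end Main

end RepStability

theorem mainTheorem3 (k : ℕ) {V : Type*} [AddCommGroup V] [Module ℚ V] [FiniteDimensional ℚ V]
    (ρ : Representation ℚ (Equiv.Perm (Fin k)) V) :
    (RepStability.inducedSequence ρ).IsMonotone k ∧
      (RepStability.inducedSequence ρ).IsUniformlyRepresentationStable (2 * k) :=
  ⟨RepStability.inducedSequence_isMonotone ρ,
    RepStability.inducedSequence_isUniformlyRepresentationStable ρ⟩
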